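/- An instance of Budgeted Red-Blue Median consists of finite sets $C$ (clients), $\mathcal R$ (red facilities) and $\mathcal B$ (blue facilities) located in a metric space with distance $d$ (several clients or facilities may share a location), and of integers $0 \le k_r \le |\mathcal R|$, $0 \le k_b \le |\mathcal B|$ with $k_r + k_b \ge 1$. A feasible solution is a pair $(R,B)$ with $R \subseteq \mathcal R$, $|R| = k_r$ and $B \subseteq \mathcal B$, $|B| = k_b$; its cost is $\mathrm{cost}(R \cup B) = \sum_{j \in C} \min_{i \in R \cup B} d(i,j)$, and $OPT$ is the minimum cost of a feasible solution. A feasible solution $(R,B)$ is locally optimum for the $p$-swap heuristic if there is no feasible solution $(R',B')$ with $|R \setminus R'| \le p$, $|B \setminus B'| \le p$ and $\mathrm{cost}(R' \cup B') < \mathrm{cost}(R \cup B)$. Theorem. Any solution that is locally optimum for the $p$-swap heuristic has cost at most $(5 + O(1/\sqrt p)) \cdot OPT$. That is, there are absolute constants $\gamma$ and $p_0$ such that for every integer $p \ge p_0$, every instance of Budgeted Red-Blue Median and every solution $(R,B)$ of it that is locally optimum for the $p$-swap heuristic, $$\mathrm{cost}(R \cup B) \le \Bigl(5 + \frac{\gamma}{\sqrt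 p}\Bigr) \cdot OPT.$$ -/

import Mathlib

/-- An instance of Budgeted Red-Blue Median in a (pseudo)metric space `X`: finite sets of clients,
red facilities and blue facilities, with the numbers `kr`, `kb` of red and blue facilities to open.
Distinct points of `X` may be at distance `0`, so several clients or facilities may be co-located.
The sets need not be disjoint. -/
structure RedBlueMedian (X : Type*) where
  /-- the clients -/
  clients : Finset X
  /-- the red facilities -/
  red : Finset X
  /-- the blue facilities -/
  blue : Finset X
  /-- number of red facilities to open -/
  kr : ℕ
  /-- number of blue facilities to open -/
  kb : ℕ
  kr_le : kr ≤ red.card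
  kb_le : kb ≤ blue.card
  /-- at least one facility is to be opened -/
  budget_pos : 0 < kr + kb

namespace RedBlueMedian

/-- Distance from `j` to the nearest point of `F`, that is `min_{i ∈ F} d(i, j)`. (The value for
empty `F` is irrelevant: the facilities opened by a feasible solution are a nonempty set.) -/
noncomputable def connectionCost {X : Type*} [PseudoMetricSpace X] (F : Finset X) (j : X) : ℝ :=
  if h : F.Nonempty then F.inf' h (fun i => dist i j) else 0

/-- `cost(F) = ∑_{j ∈ C} min_{i ∈ F} d(i, j)`. -/
noncomputable def cost {X : Type*} [PseudoMetricSpace X] (I : RedBlueMedian X)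
    (F : Finset X) : ℝ :=
  ∑ j ∈ I.clients, connectionCost F j

/-- The feasible solutions: pairs `(R, B)` of a set of `kr` red facilities and a set of `kb` blue
facilities. -/
def feasible {X : Type*} (I : RedBlueMedian X) : Finset (Finset X × Finset X) :=
  I.red.powersetCard I.kr ×ˢ I.blue.powersetCard I.kb

theorem feasible_nonempty {X : Type*} (I : RedBlueMedian X) : I.feasible.Nonempty :=
  Finset.Nonempty.product (Finset.powersetCard_nonempty.2 I.kr_le)
    (Finset.powersetCard_nonempty.2 I.kb_le)

/-- The optimum value: the least cost of a feasible solution. -/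
noncomputable def opt {X : Type*} [PseudoMetricSpace X] [DecidableEq X]
    (I : RedBlueMedian X) : ℝ :=
  I.feasible.inf' I.feasible_nonempty (fun s => I.cost (s.1 ∪ s.2))

/-- `(R, B)` is locally optimum for the `p`-swap heuristic: it is feasible, and no feasible solution
that arises from it by swapping at most `p` facilities of each colour is cheaper. -/
def IsLocalOpt {X : Type*} [PseudoMetricSpace X] [DecidableEq X]
    (I : RedBlueMedian X) (p : ℕ) (R B : Finset X) : Prop :=
  (R, B) ∈ I.feasible ∧
    ∀ R' B' : Finset X, (R', B') ∈ I.feasible → (R \ R').card ≤ p → (B \ B').card ≤ p →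
      ¬ I.cost (R' ∪ B') < I.cost (R ∪ B)

end RedBlueMedian

/-!
Local search for Budgeted Red-Blue Median.

Let `S` be the facilities of a local optimum and `O` those of an optimum, let `φ o` be the member
of `S` nearest to `o ∈ O`, to which `o` is said to be attached, and let `cent s` be the nearest to
`s` among the facilities attached to `s`. Consider a client served by `a ∈ S` at distance `c` and by
`o ∈ O` at distance `c'`. Opening `o` adds at most `min 0 (c' - c)` to its cost. If `a` is closed and
`o` is not opened, the client moves to `φ o`, which adds at most `2 * c'` (an amount that also covers
the case in which `o` is opened, together with `min 0 (c' - c)`). If `φ o` is closed too, the client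
moves to `cent (φ o)`, which adds at most `3 * c' + c`. So it suffices to find a weighted family of
exchanges that opens every `o` with weight about `1`, closes every `a` with weight at most about `2`,
and pays for each closing of `a` and `φ o` without `o` with a further unit of opening `o` and a unit
less of closing `a`: this gives `(c' - c) + 2 * 2 * c' = 5 * c' - c` per client
(`SwapPlan.sum_dist_le`).

An exchange has to respect the numbers of red and of blue facilities, and a swap is limited to `p`
facilities. The limit is dealt with by `exists_grouping`. If at most `M` facilities are attached to
each closed one, the closed facilities with what is attached to them are vectors in `ℤ²` (red and
blue balance) in a box of side `O(M)`, and the planar Steinitz lemma splits any balanced exchange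
into balanced swaps of `O(M ^ 2)` facilities (`exists_nonneg_labelling`). Each such vector involves
only one closed facility, so that `M` may be of the order `√p`, which gives the error term.

It remains to balance the colours in the presence of heavy facilities of `S`, to which more than
`6 * k` facilities are attached, where `k` has the order `√p` (`exists_swapPlan`). They are
outnumbered, by a factor of order `k`, by the lonely facilities, to which nothing is attached, and
so for the colour `β` with more lonely facilities a loss as large as the number of heavy facilities
is made up for by leaving out, in turn, a fraction `1 / k` of `O` (`exists_balanced_exchanges`). For
the other colour `ρ`, either the lonely facilities can be closed a second time in place of the heavy
ones (`exists_swapPlan_of_card_heavy_le`), or the heavy facilities of colour `ρ` are closed and the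
facilities of colour `β` attached to them are opened with weight `2`
(`exists_swapPlan_of_lt_card_heavy`). That these two cases suffice is a matter of counting the
facilities of each colour (`card_lonely_add`).
-/

open Finset

/-! ### Zero-sum decompositions of planar integer vectors -/

theorem exists_chain_of_step {ι : Type*} [DecidableEq ι] (s : Finset ι) (P : Finset ι → Prop)
    (h0 : P ∅) (hstep : ∀ T ⊆ s, P T → T ≠ s → ∃ v ∈ s \ T, P (insert v T)) :
    ∃ C : ℕ → Finset ι, Monotone C ∧ ∀ n ≤ s.card, C n ⊆ s ∧ P (C n) ∧ (C n).card = n := by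
  classical
  have hex : ∀ T : Finset ι, ∃ T' : Finset ι, T ⊆ T' ∧ (T ⊆ s → P T → T ≠ s →
      T' ⊆ s ∧ P T' ∧ T'.card = T.card + 1) := by
    intro T
    by_cases h : T ⊆ s ∧ P T ∧ T ≠ s
    · obtain ⟨v, hv, hP⟩ := hstep T h.1 h.2.1 h.2.2
      rw [mem_sdiff] at hv
      exact ⟨insert v T, subset_insert _ _, fun _ _ _ =>
        ⟨insert_subset hv.1 h.1, hP, card_insert_of_notMem hv.2⟩⟩
    · exact ⟨T, Subset.rfl, fun h1 h2 h3 => absurd ⟨h1, h2, h3⟩ h⟩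
  choose step hsub hst using hex
  refine ⟨fun n => step^[n] ∅, monotone_nat_of_le_succ fun n => ?_, fun n => ?_⟩
  · rw [Function.iterate_succ_apply']
    exact hsub _
  · induction n with
    | zero => exact fun _ => ⟨empty_subset _, h0, rfl⟩
    | succ n ih =>
      intro hn
      beta_reduce at ih
      obtain ⟨h1, h2, h3⟩ := ih (by omega)
      have hne : step^[n] ∅ ≠ s := by
        intro h
        rw [h] at h3
        omega
      have := hst _ h1 h2 hne
      simp only [Function.iterate_succ_apply']
      exact ⟨this.1, this.2.1, by rw [this.2.2, h3]⟩

/-- In one dimension, a partial sum of a zero-sum family can always be continued so that it stays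
within the bound on the single terms. -/
theorem exists_next_abs_le {ι : Type*} [DecidableEq ι] {L A : Finset ι} {f : ι → ℤ} {K : ℤ}
    (hK : ∀ v ∈ L, |f v| ≤ K) (h0 : ∑ v ∈ L, f v = 0) (hAL : A ⊆ L) (hne : (L \ A).Nonempty)
    (hA : |∑ v ∈ A, f v| ≤ K) : ∃ v ∈ L \ A, |∑ w ∈ A, f w + f v| ≤ K := by
  have hsum : ∑ v ∈ L \ A, f v = -∑ v ∈ A, f v := by
    have := sum_sdiff (f := f) hAL
    omega
  have hb : ∀ v ∈ L \ A, -K ≤ f v ∧ f v ≤ K := fun v hv =>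
    abs_le.1 (hK v (sdiff_subset hv))
  rw [abs_le] at hA
  by_cases hpos : 0 < ∑ v ∈ A, f v
  · obtain ⟨v, hv, hfv⟩ : ∃ v ∈ L \ A, f v < 0 := by
      by_contra! hcon
      have := sum_nonneg hcon
      omega
    have := hb v hv
    exact ⟨v, hv, abs_le.2 ⟨by omega, by omega⟩⟩
  · obtain ⟨v, hv, hfv⟩ : ∃ v ∈ L \ A, 0 ≤ f v := by
      by_contra! hcon
      have := sum_lt_sum_of_nonempty hne hcon
      simp only [sum_const_zero] at this
      omega
    have := hb v hv
    exact ⟨v, hv, abs_le.2 ⟨by omega, by omega⟩⟩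

/-- Planar Steinitz lemma, in the form of its consequence for integer vectors: a nonempty zero-sum
family of vectors `(f v, g v)` in the box `[-M, M]²` has a nonempty zero-sum subfamily of at most
`(8 * M + 1) ^ 2` members. -/
theorem exists_small_zero_sum {ι : Type*} [DecidableEq ι] (s : Finset ι) (hs : s.Nonempty)
    (f g : ι → ℤ) (M : ℕ) (hf : ∀ v ∈ s, |f v| ≤ M) (hg : ∀ v ∈ s, |g v| ≤ M)
    (hf0 : ∑ v ∈ s, f v = 0) (hg0 : ∑ v ∈ s, g v = 0) :
    ∃ T ⊆ s, T.Nonempty ∧ T.card ≤ (8 * M + 1) ^ 2 ∧ ∑ v ∈ T, f v = 0 ∧ ∑ v ∈ T, g v = 0 := by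
  obtain ⟨T₀, hT₀s, hmax⟩ := exists_max_image s.powerset
    (fun T => (∑ v ∈ T, f v) ^ 2 + (∑ v ∈ T, g v) ^ 2) ⟨∅, empty_mem_powerset s⟩
  rw [mem_powerset] at hT₀s
  simp only [mem_powerset] at hmax
  obtain ⟨p, hp⟩ : ∃ p, p = ∑ v ∈ T₀, f v := ⟨_, rfl⟩
  obtain ⟨q, hq⟩ : ∃ q, q = ∑ v ∈ T₀, g v := ⟨_, rfl⟩
  rw [← hp, ← hq] at hmax
  have hin : ∀ v ∈ T₀, 0 ≤ p * f v + q * g v := by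
    intro v hv
    have := hmax (T₀.erase v) ((erase_subset _ _).trans hT₀s)
    rw [sum_erase_eq_sub hv, sum_erase_eq_sub hv, ← hp, ← hq] at this
    nlinarith [sq_nonneg (f v), sq_nonneg (g v)]
  have hout : ∀ v ∈ s, v ∉ T₀ → p * f v + q * g v ≤ 0 := by
    intro v hvs hv
    have := hmax (insert v T₀) (insert_subset hvs hT₀s)
    rw [sum_insert hv, sum_insert hv, ← hp, ← hq] at this
    nlinarith [sq_nonneg (f v), sq_nonneg (g v)]
  have hN : 1 ≤ (8 * M + 1) ^ 2 := Nat.one_le_pow _ _ (by omega)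
  by_cases hD : p ^ 2 + q ^ 2 = 0
  · obtain ⟨v, hv⟩ := hs
    have := hmax {v} (singleton_subset_iff.2 hv)
    rw [hD, sum_singleton, sum_singleton] at this
    refine ⟨{v}, singleton_subset_iff.2 hv, singleton_nonempty v, by simpa using hN, ?_, ?_⟩
    · rw [sum_singleton]
      exact pow_eq_zero_iff (two_ne_zero) |>.1 (by nlinarith [sq_nonneg (f v), sq_nonneg (g v)])
    · rw [sum_singleton]
      exact pow_eq_zero_iff (two_ne_zero) |>.1 (by nlinarith [sq_nonneg (f v), sq_nonneg (g v)])
  have hDpos : 0 < p ^ 2 + q ^ 2 := lt_of_le_of_ne (by positivity) (Ne.symm hD)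
  -- the components along the direction `(p, q)` and perpendicular to it
  let a : ι → ℤ := fun v => p * f v + q * g v
  let b : ι → ℤ := fun v => p * g v - q * f v
  let K : ℤ := M * (|p| + |q|)
  have habs : ∀ x y z w : ℤ, |z| ≤ M → |w| ≤ M → |x| + |y| = |p| + |q| → |x * z + y * w| ≤ K := by
    intro x y z w hz hw hxy
    calc |x * z + y * w| ≤ |x * z| + |y * w| := abs_add_le _ _
      _ = |x| * |z| + |y| * |w| := by rw [abs_mul, abs_mul]
      _ ≤ |x| * M + |y| * M := by gcongr
      _ = K := by simp only [K, ← hxy]; ring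
  have haK : ∀ v ∈ s, |a v| ≤ K := fun v hv => habs p q _ _ (hf v hv) (hg v hv) rfl
  have hbK : ∀ v ∈ s, |b v| ≤ K := by
    intro v hv
    have := habs p (-q) _ _ (hg v hv) (hf v hv) (by rw [abs_neg])
    simpa only [b, sub_eq_add_neg, neg_mul] using this
  have hK0 : 0 ≤ K := by positivity
  have hsuma : ∀ T : Finset ι, ∑ v ∈ T, a v = p * ∑ v ∈ T, f v + q * ∑ v ∈ T, g v := by
    intro T
    simp only [a, sum_add_distrib, mul_sum]
  have hsumb : ∀ T : Finset ι, ∑ v ∈ T, b v = p * ∑ v ∈ T, g v - q * ∑ v ∈ T, f v := by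
    intro T
    simp only [b, sum_sub_distrib, mul_sum]
  have hb₀ : ∑ v ∈ T₀, b v = 0 := by
    rw [hsumb, ← hp, ← hq]; ring
  have hb₁ : ∑ v ∈ s \ T₀, b v = 0 := by
    have := sum_sdiff (f := b) hT₀s
    rw [hb₀, hsumb s, hf0, hg0] at this
    simpa using this
  have has : ∑ v ∈ s, a v = 0 := by rw [hsuma, hf0, hg0]; ring
  -- `T` is a union of an initial part of an ordering of `T₀` and one of `s \ T₀`
  let P : Finset ι → Prop := fun T =>
    |∑ v ∈ T ∩ T₀, b v| ≤ K ∧ |∑ v ∈ T \ T₀, b v| ≤ K ∧ |∑ v ∈ T, a v| ≤ K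
  have hstep : ∀ T ⊆ s, P T → T ≠ s → ∃ v ∈ s \ T, P (insert v T) := by
    intro T hTs hPT hne
    obtain ⟨h1, h2, h3⟩ := hPT
    have h3' := abs_le.1 h3
    have hrest : ∑ v ∈ s \ T, a v = -∑ v ∈ T, a v := by
      have := sum_sdiff (f := a) hTs
      omega
    have hsT : (s \ T).Nonempty := by
      rw [sdiff_nonempty]
      exact fun h => hne (Subset.antisymm hTs h)
    have hadd₀ : (T₀ \ (T ∩ T₀)).Nonempty → ∑ v ∈ T, a v ≤ 0 →
        ∃ v ∈ s \ T, P (insert v T) := by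
      intro hn hle
      obtain ⟨v, hv, hvb⟩ := exists_next_abs_le (f := b) (fun v hv => hbK v (hT₀s hv)) hb₀
        inter_subset_right hn h1
      simp only [mem_sdiff, mem_inter, not_and] at hv
      have hvT : v ∉ T := fun h => hv.2 h hv.1
      have hva := abs_le.1 (haK v (hT₀s hv.1))
      have hva' : 0 ≤ a v := hin v hv.1
      refine ⟨v, mem_sdiff.2 ⟨hT₀s hv.1, hvT⟩, ?_, ?_, ?_⟩
      · rw [insert_inter_of_mem hv.1, sum_insert (by simp [hvT]), add_comm]
        exact hvb
      · rwa [insert_sdiff_of_mem _ hv.1]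
      · rw [sum_insert hvT]
        exact abs_le.2 ⟨by omega, by omega⟩
    have hadd₁ : ((s \ T₀) \ (T \ T₀)).Nonempty → 0 ≤ ∑ v ∈ T, a v →
        ∃ v ∈ s \ T, P (insert v T) := by
      intro hn hle
      obtain ⟨v, hv, hvb⟩ := exists_next_abs_le (f := b)
        (fun v hv => hbK v (sdiff_subset hv)) hb₁ (sdiff_subset_sdiff hTs Subset.rfl) hn h2
      simp only [mem_sdiff, not_and, not_not] at hv
      have hvT : v ∉ T := fun h => hv.1.2 (hv.2 h)
      have hva := abs_le.1 (haK v hv.1.1)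
      have hva' : a v ≤ 0 := hout v hv.1.1 hv.1.2
      refine ⟨v, mem_sdiff.2 ⟨hv.1.1, hvT⟩, ?_, ?_, ?_⟩
      · rwa [insert_inter_of_notMem hv.1.2]
      · rw [insert_sdiff_of_notMem _ hv.1.2, sum_insert (by simp [hvT]), add_comm]
        exact hvb
      · rw [sum_insert hvT]
        exact abs_le.2 ⟨by omega, by omega⟩
    by_cases hn₀ : (T₀ \ (T ∩ T₀)).Nonempty
    · by_cases hn₁ : ((s \ T₀) \ (T \ T₀)).Nonempty
      · rcases le_total (∑ v ∈ T, a v) 0 with h | h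
        · exact hadd₀ hn₀ h
        · exact hadd₁ hn₁ h
      · refine hadd₀ hn₀ ?_
        have : 0 ≤ ∑ v ∈ s \ T, a v := by
          refine sum_nonneg fun v hv => ?_
          rw [mem_sdiff] at hv
          by_cases hvT₀ : v ∈ T₀
          · exact hin v hvT₀
          · exact absurd ⟨v, by simp [hv.1, hv.2, hvT₀]⟩ hn₁
        omega
    · have hn₁ : ((s \ T₀) \ (T \ T₀)).Nonempty := by
        obtain ⟨v, hv⟩ := hsT
        rw [mem_sdiff] at hv
        refine ⟨v, ?_⟩
        have hvT₀ : v ∉ T₀ := fun h => hn₀ ⟨v, by simp [hv.2, h]⟩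
        simp [hv.1, hv.2, hvT₀]
      refine hadd₁ hn₁ ?_
      have : ∑ v ∈ s \ T, a v ≤ 0 := by
        refine sum_nonpos fun v hv => ?_
        rw [mem_sdiff] at hv
        by_cases hvT₀ : v ∈ T₀
        · exact absurd ⟨v, by simp [hv.2, hvT₀]⟩ hn₀
        · exact hout v hv.1 hvT₀
      omega
  have hP0 : P ∅ := by simp [P, hK0]
  obtain ⟨C, hmono, hC⟩ := exists_chain_of_step s P hP0 hstep
  by_cases hcard : s.card ≤ (8 * M + 1) ^ 2
  · exact ⟨s, Subset.rfl, hs, hcard, hf0, hg0⟩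
  push Not at hcard
  -- all the partial sums lie in the box `[-4M, 4M]²`, which has `(8M+1)²` lattice points
  have hbox : ∀ T, P T → |∑ v ∈ T, f v| ≤ 4 * M ∧ |∑ v ∈ T, g v| ≤ 4 * M := by
    intro T ⟨h1, h2, h3⟩
    have hb : |∑ v ∈ T, b v| ≤ 2 * K := by
      rw [← sum_inter_add_sum_sdiff T T₀ b]
      exact (abs_add_le _ _).trans (by omega)
    have key : ∀ x y z : ℤ, z * (p ^ 2 + q ^ 2) = x * (∑ v ∈ T, a v) + y * ∑ v ∈ T, b v →
        |x| + |y| = |p| + |q| → |z| ≤ 4 * M := by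
      intro x y z hz hxy
      have e1 : |z| * (p ^ 2 + q ^ 2) ≤ |x| * K + |y| * (2 * K) := by
        rw [← abs_of_pos hDpos, ← abs_mul, hz]
        refine (abs_add_le _ _).trans ?_
        rw [abs_mul, abs_mul]
        gcongr
      have e2 : |x| * K + |y| * (2 * K) ≤ 2 * K * (|p| + |q|) := by
        rw [← hxy]
        nlinarith [mul_nonneg (abs_nonneg x) hK0]
      have e3 : (|p| + |q|) ^ 2 ≤ 2 * (p ^ 2 + q ^ 2) := by
        nlinarith [sq_nonneg (|p| - |q|), sq_abs p, sq_abs q]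
      have e4 : 2 * K * (|p| + |q|) ≤ 4 * M * (p ^ 2 + q ^ 2) := by
        have : 2 * K * (|p| + |q|) = 2 * M * (|p| + |q|) ^ 2 := by simp only [K]; ring
        rw [this]
        have hM : (0 : ℤ) ≤ M := by positivity
        nlinarith
      exact le_of_mul_le_mul_right (e1.trans (e2.trans e4)) hDpos
    constructor
    · refine key p (-q) _ ?_ (by rw [abs_neg])
      rw [hsuma, hsumb]; ring
    · refine key q p _ ?_ (add_comm _ _)
      rw [hsuma, hsumb]; ring
  have hIcc : (Icc (-(4 * M : ℤ)) (4 * M)).card = 8 * M + 1 := by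
    rw [Int.card_Icc]; omega
  have hmaps : ∀ n ∈ range ((8 * M + 1) ^ 2 + 1), (∑ v ∈ C n, f v, ∑ v ∈ C n, g v) ∈
      Icc (-(4 * M : ℤ)) (4 * M) ×ˢ Icc (-(4 * M : ℤ)) (4 * M) := by
    intro n hn
    rw [mem_range] at hn
    have := hbox _ (hC n (by omega)).2.1
    rw [mem_product, mem_Icc, mem_Icc]
    exact ⟨abs_le.1 this.1, abs_le.1 this.2⟩
  obtain ⟨i, hi, j, hj, hij, he⟩ := exists_ne_map_eq_of_card_lt_of_maps_to
    (by rw [card_product, hIcc, card_range, ← sq]; exact Nat.lt_succ_self _) hmaps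
  wlog hlt : i < j generalizing i j
  · exact this j hj i hi hij.symm he.symm (by omega)
  rw [mem_range] at hi hj
  obtain ⟨hfe, hge⟩ := Prod.mk.inj he
  have hsub : C i ⊆ C j := hmono hlt.le
  have hcd : (C j \ C i).card = j - i := by
    rw [card_sdiff_of_subset hsub, (hC j (by omega)).2.2, (hC i (by omega)).2.2]
  refine ⟨C j \ C i, sdiff_subset.trans (hC j (by omega)).1, ?_, by omega, ?_, ?_⟩
  · rw [← card_pos]; omega
  · rw [sum_sdiff_eq_sub hsub, hfe, sub_self]
  · rw [sum_sdiff_eq_sub hsub, hge, sub_self]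

/-- A zero-sum family of planar integer vectors in the box `[-M, M]²` splits into zero-sum classes
(the fibres of `L`) of at most `(8 * M + 1) ^ 2` members each. -/
theorem exists_zero_sum_labelling {ι : Type*} [DecidableEq ι] (f g : ι → ℤ) (M : ℕ)
    (s : Finset ι) (hf : ∀ v ∈ s, |f v| ≤ M) (hg : ∀ v ∈ s, |g v| ≤ M)
    (hf0 : ∑ v ∈ s, f v = 0) (hg0 : ∑ v ∈ s, g v = 0) :
    ∃ L : ι → ℕ, ∀ n, (s.filter (L · = n)).card ≤ (8 * M + 1) ^ 2 ∧
      ∑ v ∈ s.filter (L · = n), f v = 0 ∧ ∑ v ∈ s.filter (L · = n), g v = 0 := by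
  induction s using Finset.strongInduction with
  | H s ih =>
    rcases s.eq_empty_or_nonempty with rfl | hs
    · exact ⟨fun _ => 0, by simp⟩
    obtain ⟨T, hTs, hTn, hTc, hTf, hTg⟩ := exists_small_zero_sum s hs f g M hf hg hf0 hg0
    obtain ⟨L, hL⟩ := ih (s \ T) (sdiff_ssubset hTs hTn)
      (fun v hv => hf v (sdiff_subset hv)) (fun v hv => hg v (sdiff_subset hv))
      (by rw [sum_sdiff_eq_sub hTs, hf0, hTf, sub_self])
      (by rw [sum_sdiff_eq_sub hTs, hg0, hTg, sub_self])
    refine ⟨fun v => if v ∈ T then 0 else L v + 1, fun n => ?_⟩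
    rcases n with _ | n
    · have : s.filter (fun v => (if v ∈ T then 0 else L v + 1) = 0) = T := by
        ext v
        rw [mem_filter]
        constructor
        · rintro ⟨-, h⟩
          by_contra hv
          simp [hv] at h
        · exact fun h => ⟨hTs h, by simp [h]⟩
      rw [this]
      exact ⟨hTc, hTf, hTg⟩
    · have : s.filter (fun v => (if v ∈ T then 0 else L v + 1) = n + 1)
          = (s \ T).filter (L · = n) := by
        ext v
        by_cases hv : v ∈ T <;> simp [hv]
      rw [this]
      exact hL n

/-- If the sum of the vectors is only nonnegative in both coordinates, the classes can be chosen
with nonnegative sums. -/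
theorem exists_nonneg_labelling {ι : Type*} [Fintype ι] [DecidableEq ι] (f g : ι → ℤ) (M : ℕ)
    (hM : 1 ≤ M) (hf : ∀ v, |f v| ≤ M) (hg : ∀ v, |g v| ≤ M)
    (hf0 : 0 ≤ ∑ v, f v) (hg0 : 0 ≤ ∑ v, g v) :
    ∃ L : ι → ℕ, ∀ n, (univ.filter (L · = n)).card ≤ (8 * M + 1) ^ 2 ∧
      0 ≤ ∑ v with L v = n, f v ∧ 0 ≤ ∑ v with L v = n, g v := by
  -- the surplus is absorbed by additional vectors `(-1, 0)` and `(0, -1)`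
  obtain ⟨x, hx⟩ := Int.eq_ofNat_of_zero_le hf0
  obtain ⟨y, hy⟩ := Int.eq_ofNat_of_zero_le hg0
  let f' : ι ⊕ (Fin x ⊕ Fin y) → ℤ := Sum.elim f (Sum.elim (fun _ => -1) fun _ => 0)
  let g' : ι ⊕ (Fin x ⊕ Fin y) → ℤ := Sum.elim g (Sum.elim (fun _ => 0) fun _ => -1)
  have hM' : (1 : ℤ) ≤ M := by exact_mod_cast hM
  obtain ⟨L, hL⟩ := exists_zero_sum_labelling f' g' M univ
    (by rintro (v | v | v) -
        · exact hf v
        · simpa [f'] using hM'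
        · simp [f'])
    (by rintro (v | v | v) -
        · exact hg v
        · simp [g']
        · simpa [g'] using hM')
    (by simp [f', hx]) (by simp [g', hy])
  refine ⟨fun v => L (Sum.inl v), fun n => ?_⟩
  obtain ⟨h1, h2, h3⟩ := hL n
  refine ⟨le_trans ?_ h1, ?_, ?_⟩
  · refine card_le_card_of_injOn Sum.inl ?_ Sum.inl_injective.injOn
    intro v hv
    simpa using hv
  · rw [sum_filter, Fintype.sum_sum_type] at h2
    rw [sum_filter]
    have : ∑ z : Fin x ⊕ Fin y, (if L (Sum.inr z) = n then f' (Sum.inr z) else 0) ≤ 0 := by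
      refine sum_nonpos fun z _ => ?_
      split_ifs
      · rcases z with z | z <;> simp [f']
      · exact le_rfl
    simp only [f', Sum.elim_inl] at h2 this
    linarith
  · rw [sum_filter, Fintype.sum_sum_type] at h3
    rw [sum_filter]
    have : ∑ z : Fin x ⊕ Fin y, (if L (Sum.inr z) = n then g' (Sum.inr z) else 0) ≤ 0 := by
      refine sum_nonpos fun z _ => ?_
      split_ifs
      · rcases z with z | z <;> simp [g']
      · exact le_rfl
    simp only [g', Sum.elim_inl] at h3 this
    linarith

/-! ### Splitting a large balanced exchange into bounded balanced exchanges -/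

/-- Suppose that the facilities `A` may be closed and the facilities `I` may be opened, that `I` has
at most as many members of each colour as `A`, and that at most `M` members of `I` are attached by
`φ` to each `s ∈ A`. Then the exchange splits into exchanges with the same balance of colours, each
closing `O(M ^ 2)` facilities, such that `s ∈ A` is closed together with the opening of all members
of `I` attached to it. -/
theorem exists_grouping {S O : Type*} [Fintype S] [Fintype O] [DecidableEq S] [DecidableEq O]
    (colS : S → Bool) (colO : O → Bool) (φ : O → S) (A : Finset S) (I : Finset O) (M : ℕ)
    (hM : 1 ≤ M)
    (hcard : ∀ c, (I.filter (colO · = c)).card ≤ (A.filter (colS · = c)).card)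
    (hfib : ∀ s ∈ A, (I.filter (φ · = s)).card ≤ M) :
    ∃ (LS : S → ℕ) (LO : O → ℕ), (∀ o, φ o ∈ A → LO o = LS (φ o)) ∧
      ∀ n, (A.filter (LS · = n)).card ≤ (8 * M + 1) ^ 2 ∧
        ∀ c, (I.filter fun o => LO o = n ∧ colO o = c).card ≤
          (A.filter fun s => LS s = n ∧ colS s = c).card := by
  let e : O → S ⊕ O := fun o => if φ o ∈ A then Sum.inl (φ o) else Sum.inr o
  -- the vector of `s ∈ A` is its colour minus the colours of the members of `I` attached to it;
  -- a member of `I` attached to no member of `A` forms a vector of its own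
  let v : Bool → S ⊕ O → ℤ := fun c => Sum.elim
    (fun s => if s ∈ A then (if colS s = c then 1 else 0) -
      ((I.filter fun o => φ o = s ∧ colO o = c).card : ℤ) else 0)
    (fun o => if o ∈ I ∧ φ o ∉ A ∧ colO o = c then -1 else 0)
  have hM' : (1 : ℤ) ≤ M := by exact_mod_cast hM
  have hv : ∀ c z, |v c z| ≤ M := by
    rintro c (s | o)
    · simp only [v, Sum.elim_inl]
      split_ifs with hs hc
      · have h1 : (I.filter fun o => φ o = s ∧ colO o = c).card ≤ M :=
          (card_le_card (monotone_filter_right _ fun o _ h => h.1)).trans (hfib s hs)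
        rw [abs_le]
        constructor <;> omega
      · have h1 : (I.filter fun o => φ o = s ∧ colO o = c).card ≤ M :=
          (card_le_card (monotone_filter_right _ fun o _ h => h.1)).trans (hfib s hs)
        rw [abs_le]
        constructor <;> omega
      · simp
    · simp only [v, Sum.elim_inr]
      split_ifs <;> simp [hM]
  have hsum : ∀ (c : Bool) (q : S ⊕ O → Prop) [DecidablePred q],
      ∑ z with q z, v c z = ((A.filter fun s => q (Sum.inl s) ∧ colS s = c).card : ℤ) -
        ((I.filter fun o => q (e o) ∧ colO o = c).card : ℤ) := by
    intro c q _
    have h1 : (A.filter fun s => q (Sum.inl s) ∧ colS s = c) =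
        univ.filter fun s => s ∈ A ∧ q (Sum.inl s) ∧ colS s = c := by ext; simp
    have h2 : ((I.filter fun o => q (e o) ∧ colO o = c).card : ℤ) =
        (∑ s, if s ∈ A ∧ q (Sum.inl s) then
          ((I.filter fun o => φ o = s ∧ colO o = c).card : ℤ) else 0) +
        ∑ o, if o ∈ I ∧ φ o ∉ A ∧ colO o = c ∧ q (Sum.inr o) then 1 else 0 := by
      have h3 : ∀ s, (if s ∈ A ∧ q (Sum.inl s) then
          ((I.filter fun o => φ o = s ∧ colO o = c).card : ℤ) else 0) =
          ∑ o, if s = φ o then (if φ o ∈ A ∧ q (Sum.inl (φ o)) ∧ o ∈ I ∧ colO o = c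
            then 1 else 0) else 0 := by
        intro s
        have : (I.filter fun o => φ o = s ∧ colO o = c) =
          univ.filter fun o => o ∈ I ∧ φ o = s ∧ colO o = c := by ext; simp
        rw [this, card_filter]
        push_cast
        split_ifs with h
        · refine sum_congr rfl fun o _ => ?_
          by_cases hs : s = φ o
          · subst hs
            simp [h.1, h.2]
          · simp [hs, Ne.symm hs]
        · refine (sum_eq_zero fun o _ => ?_).symm
          split_ifs with h4 h5
          · subst h4
            exact absurd ⟨h5.1, h5.2.1⟩ h
          · rfl
          · rfl
      rw [sum_congr rfl fun s _ => h3 s, sum_comm, ← sum_add_distrib]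
      have : (I.filter fun o => q (e o) ∧ colO o = c) =
          univ.filter fun o => o ∈ I ∧ q (e o) ∧ colO o = c := by ext; simp
      rw [this, card_filter]
      push_cast
      refine sum_congr rfl fun o _ => ?_
      rw [sum_ite_eq' univ (φ o), if_pos (mem_univ _)]
      by_cases hA : φ o ∈ A
      · simp only [e, hA, if_true, true_and, not_true_eq_false, false_and, and_false, if_false,
          add_zero]
        congr 1
        exact propext (by tauto)
      · simp only [e, hA, if_false, false_and, not_false_eq_true, true_and, zero_add]
        congr 1
        exact propext (by tauto)
    rw [sum_filter, Fintype.sum_sum_type, h1, card_filter, h2]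
    push_cast
    rw [sub_add_eq_sub_sub, ← sum_sub_distrib, sub_eq_add_neg, ← sum_neg_distrib]
    congr 1
    · refine sum_congr rfl fun s _ => ?_
      simp only [v, Sum.elim_inl]
      by_cases hs : s ∈ A <;> by_cases hq : q (Sum.inl s) <;> simp [hs, hq]
    · refine sum_congr rfl fun o _ => ?_
      simp only [v, Sum.elim_inr]
      by_cases hq : q (Sum.inr o) <;> simp [hq, apply_ite Neg.neg]
  have htot : ∀ c, 0 ≤ ∑ z, v c z := by
    intro c
    have := hsum c fun _ => True
    simp only [true_and, filter_true] at this
    rw [this, sub_nonneg]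
    exact_mod_cast hcard c
  obtain ⟨L, hL⟩ := exists_nonneg_labelling (v true) (v false) M hM (hv _) (hv _) (htot _) (htot _)
  refine ⟨fun s => L (Sum.inl s), fun o => L (e o), fun o ho => by simp [e, ho], fun n => ?_⟩
  obtain ⟨h1, h2, h3⟩ := hL n
  refine ⟨le_trans ?_ h1, fun c => ?_⟩
  · refine card_le_card_of_injOn Sum.inl ?_ Sum.inl_injective.injOn
    intro s hs
    have := (mem_filter.1 (mem_coe.1 hs)).2
    simpa using this
  · rw [hsum _ (L · = n), sub_nonneg] at h2 h3
    cases c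
    · exact_mod_cast h3
    · exact_mod_cast h2

/-! ### The inequality given by one exchange -/

/-- The inequality that local optimality gives for closing the facilities `A` and opening the
facilities `I`. Here `pS`, `pO` are the locations of the facilities of the local optimum and of the
optimum, `σ j`, `σ' j` are the facilities serving the client `j` in them, `φ o` is the facility of
the local optimum nearest to `o`, and `cent s` is the one nearest to `s` among the `o` with
`φ o = s`. The exchange is split into swaps of bounded size, so there is no bound on the size of
`A`. -/
theorem exchange_inequality {X S O : Type*} [PseudoMetricSpace X] [Fintype S] [Fintype O]
    [DecidableEq S] [DecidableEq O] (clients : Finset X) (pS : S → X) (pO : O → X)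
    (colS : S → Bool) (colO : O → Bool) (σ : X → S) (σ' : X → O) (φ : O → S) (cent : S → O)
    (p M : ℕ)
    (hφ : ∀ o s, dist (pO o) (pS (φ o)) ≤ dist (pO o) (pS s))
    (hcent : ∀ o, dist (pS (φ o)) (pO (cent (φ o))) ≤ dist (pS (φ o)) (pO o))
    (hswap : ∀ (A : Finset S) (I : Finset O),
      (∀ c, (I.filter (colO · = c)).card ≤ (A.filter (colS · = c)).card) → A.card ≤ p →
      ∀ τ : X → X, (∀ j, (∃ s, s ∉ A ∧ pS s = τ j) ∨ ∃ o ∈ I, pO o = τ j) →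
        ∑ j ∈ clients, dist (pS (σ j)) j ≤ ∑ j ∈ clients, dist (τ j) j)
    (hM : 1 ≤ M) (hp : (8 * M + 1) ^ 2 ≤ p)
    (A : Finset S) (I : Finset O)
    (hcard : ∀ c, (I.filter (colO · = c)).card ≤ (A.filter (colS · = c)).card)
    (hfib : ∀ s ∈ A, (I.filter (φ · = s)).card ≤ M)
    (hmem : ∀ o, φ o ∈ A → cent (φ o) ∈ I) (hφcent : ∀ o, φ (cent (φ o)) = φ o) :
    0 ≤ ∑ j ∈ clients,
      ((if σ' j ∈ I then min 0 (dist (pO (σ' j)) j - dist (pS (σ j)) j) else 0) +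
        if σ j ∈ A then 2 * dist (pO (σ' j)) j +
          (if φ (σ' j) ∈ A ∧ σ' j ∉ I then dist (pO (σ' j)) j + dist (pS (σ j)) j else 0)
        else 0) := by
  obtain ⟨LS, LO, hL, hgroup⟩ := exists_grouping colS colO φ A I M hM hcard hfib
  obtain ⟨N, hN⟩ : ∃ N, (∀ s, LS s < N) ∧ ∀ o, LO o < N := by
    refine ⟨univ.sup LS + univ.sup LO + 1, fun s => ?_, fun o => ?_⟩
    · have := le_sup (f := LS) (mem_univ s)
      omega
    · have := le_sup (f := LO) (mem_univ o)
      omega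
  -- the swap `n` contributes the terms of the facilities labelled `n`
  have key : ∀ n, 0 ≤ ∑ j ∈ clients,
      ((if n = LO (σ' j) then
        (if σ' j ∈ I then min 0 (dist (pO (σ' j)) j - dist (pS (σ j)) j) else 0) else 0) +
        if n = LS (σ j) then (if σ j ∈ A then 2 * dist (pO (σ' j)) j +
          (if φ (σ' j) ∈ A ∧ σ' j ∉ I then dist (pO (σ' j)) j + dist (pS (σ j)) j else 0)
        else 0) else 0) := by
    intro n
    obtain ⟨h1, h2⟩ := hgroup n
    let An : Finset S := A.filter (LS · = n)
    let In : Finset O := I.filter (LO · = n)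
    let τ : X → X := fun j =>
      if σ' j ∈ In ∧ (σ j ∈ An ∨ dist (pO (σ' j)) j ≤ dist (pS (σ j)) j) then pO (σ' j)
      else if σ j ∈ An then
        if φ (σ' j) ∈ An then pO (cent (φ (σ' j))) else pS (φ (σ' j))
      else pS (σ j)
    have hτ : ∀ j, (∃ s, s ∉ An ∧ pS s = τ j) ∨ ∃ o ∈ In, pO o = τ j := by
      intro j
      simp only [τ]
      split_ifs with h3 h4 h5
      · exact Or.inr ⟨_, h3.1, rfl⟩
      · rw [mem_filter] at h5
        refine Or.inr ⟨_, mem_filter.2 ⟨hmem _ h5.1, ?_⟩, rfl⟩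
        rw [hL _ (by rw [hφcent]; exact h5.1), hφcent]
        exact h5.2
      · exact Or.inl ⟨_, h5, rfl⟩
      · exact Or.inl ⟨_, h4, rfl⟩
    have h3 := hswap An In (fun c => by simpa only [An, In, filter_filter] using h2 c)
      (h1.trans hp) τ hτ
    rw [← sub_nonneg, ← sum_sub_distrib] at h3
    refine h3.trans (sum_le_sum fun j _ => ?_)
    have hc : 0 ≤ dist (pS (σ j)) j := dist_nonneg
    have hc' : 0 ≤ dist (pO (σ' j)) j := dist_nonneg
    have hd : dist (pO (σ' j)) (pS (φ (σ' j))) ≤ dist (pO (σ' j)) j + dist (pS (σ j)) j :=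
      (hφ _ (σ j)).trans (dist_triangle_right _ _ _)
    have hd1 : dist (pS (φ (σ' j))) j ≤ 2 * dist (pO (σ' j)) j + dist (pS (σ j)) j := by
      have := dist_triangle_left (pS (φ (σ' j))) j (pO (σ' j))
      linarith
    have hd2 : dist (pO (cent (φ (σ' j)))) j ≤
        3 * dist (pO (σ' j)) j + 2 * dist (pS (σ j)) j := by
      have e1 := dist_triangle_left (pO (cent (φ (σ' j)))) j (pS (φ (σ' j)))
      have e2 := hcent (σ' j)
      rw [dist_comm (pS (φ (σ' j))) (pO (σ' j))] at e2
      linarith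
    have hIn : σ' j ∈ In ↔ n = LO (σ' j) ∧ σ' j ∈ I := by
      simp only [In, mem_filter, eq_comm, and_comm]
    have hAn : ∀ s, s ∈ An ↔ n = LS s ∧ s ∈ A := fun s => by
      simp only [An, mem_filter, eq_comm, and_comm]
    rw [← ite_and, ← ite_and]
    simp only [← hIn, ← hAn]
    simp only [τ]
    have hextra : 0 ≤ if φ (σ' j) ∈ A ∧ σ' j ∉ I then
        dist (pO (σ' j)) j + dist (pS (σ j)) j else 0 := by
      split_ifs
      · positivity
      · exact le_rfl
    by_cases ho : σ' j ∈ In <;> by_cases ha : σ j ∈ An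
    · simp only [ho, ha, true_or, and_self, if_true]
      rcases le_total 0 (dist (pO (σ' j)) j - dist (pS (σ j)) j) with h | h
      · rw [min_eq_left h]; linarith
      · rw [min_eq_right h]; linarith
    · simp only [ho, ha, true_and, false_or, if_true, if_false, add_zero]
      split_ifs with h
      · rw [min_eq_right (by linarith)]
      · rw [min_eq_left (by linarith), sub_self]
    · simp only [ho, ha, false_and, if_false, if_true, zero_add]
      by_cases hs : φ (σ' j) ∈ An
      · have h4 : φ (σ' j) ∈ A ∧ σ' j ∉ I := by
          have h5 := (hAn _).1 hs
          refine ⟨h5.2, fun h6 => ho (hIn.2 ⟨?_, h6⟩)⟩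
          rw [hL _ h5.2]
          exact h5.1
        rw [if_pos hs, if_pos h4]
        linarith
      · rw [if_neg hs]
        linarith
    · simp [ho, ha]
  have hsum := sum_nonneg fun n (_ : n ∈ range N) => key n
  rw [sum_comm] at hsum
  refine hsum.trans_eq (sum_congr rfl fun j _ => ?_)
  rw [sum_add_distrib, sum_ite_eq' , sum_ite_eq', if_pos (mem_range.2 (hN.2 _)),
    if_pos (mem_range.2 (hN.1 _))]

/-! ### Swaps of feasible solutions -/

/-- Closing `U` and opening `W` can be completed to a solution with the same number of facilities,
even if `W` meets `F \ U`. -/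
theorem exists_completed_swap {X : Type*} [DecidableEq X] {P F U W : Finset X} (hF : F ⊆ P)
    (hU : U ⊆ F) (hW : W ⊆ P) (hcard : W.card ≤ U.card) :
    ∃ F' ⊆ P, F'.card = F.card ∧ F \ F' ⊆ U ∧ F \ U ⊆ F' ∧ W ⊆ F' := by
  obtain ⟨F', h1, h2, h3⟩ := exists_subsuperset_card_eq (s := F \ U ∪ W) (t := P) (n := F.card)
    (union_subset (sdiff_subset.trans hF) hW)
    ((card_union_le _ _).trans (by
      have := card_sdiff_of_subset hU
      have := card_le_card hU
      omega))
    (card_le_card hF)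
  rw [union_subset_iff] at h1
  refine ⟨F', h2, h3, fun x hx => ?_, h1⟩
  rw [mem_sdiff] at hx
  by_contra hxU
  exact hx.2 (h1.1 (mem_sdiff.2 ⟨hx.1, hxU⟩))

namespace RedBlueMedian

variable {X : Type*}

/-- The facilities of a pair of sets `F true` (red) and `F false` (blue), tagged with their colour,
so that a facility that is open in both colours counts twice. -/
abbrev Tagged (F : Bool → Finset X) : Type _ := (c : Bool) × {x // x ∈ F c}

/-- The location of a tagged facility. -/
def Tagged.loc {F : Bool → Finset X} (s : Tagged F) : X := s.2

/-- The facilities of one colour of a set of tagged facilities. -/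
def Tagged.part [DecidableEq X] {F : Bool → Finset X} (A : Finset (Tagged F)) (c : Bool) :
    Finset X :=
  (A.filter (·.1 = c)).image loc

theorem Tagged.mem_part [DecidableEq X] {F : Bool → Finset X} {A : Finset (Tagged F)}
    {s : Tagged F} : s.loc ∈ part A s.1 ↔ s ∈ A := by
  rw [part, mem_image]
  constructor
  · rintro ⟨t, ht, h⟩
    rw [mem_filter] at ht
    obtain ⟨c, x⟩ := s
    obtain ⟨d, y⟩ := t
    obtain ⟨ht1, rfl⟩ := ht
    have : y = x := Subtype.ext h
    rwa [← this]
  · exact fun h => ⟨s, mem_filter.2 ⟨h, rfl⟩, rfl⟩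

theorem Tagged.part_subset [DecidableEq X] {F : Bool → Finset X} (A : Finset (Tagged F))
    (c : Bool) : part A c ⊆ F c := by
  intro x hx
  obtain ⟨s, hs, rfl⟩ := mem_image.1 hx
  obtain ⟨-, rfl⟩ := mem_filter.1 hs
  exact s.2.2

theorem Tagged.card_part [DecidableEq X] {F : Bool → Finset X} (A : Finset (Tagged F))
    (c : Bool) : (part A c).card = (A.filter (·.1 = c)).card := by
  refine card_image_of_injOn fun s hs t ht h => ?_
  have hs' := (mem_filter.1 (mem_coe.1 hs)).2
  have ht' := (mem_filter.1 (mem_coe.1 ht)).2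
  obtain ⟨d, x⟩ := s
  obtain ⟨d', y⟩ := t
  obtain rfl : d = c := hs'
  obtain rfl : d' = d := ht'
  have : x = y := Subtype.ext h
  rw [this]

theorem Tagged.card_filter_univ {F : Bool → Finset X} (c : Bool) :
    ((univ : Finset (Tagged F)).filter (·.1 = c)).card = (F c).card := by
  classical
  rw [← card_part]
  congr 1
  refine Subset.antisymm (part_subset _ _) fun x hx => ?_
  exact mem_part (s := (⟨c, x, hx⟩ : Tagged F)).2 (mem_univ _)

variable [PseudoMetricSpace X]

theorem connectionCost_le {F : Finset X} {x : X} (hx : x ∈ F) (j : X) :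
    connectionCost F j ≤ dist x j := by
  rw [connectionCost, dif_pos ⟨x, hx⟩]
  exact inf'_le _ hx

theorem connectionCost_nonneg (F : Finset X) (j : X) : 0 ≤ connectionCost F j := by
  rw [connectionCost]
  split_ifs
  · exact le_inf' _ _ fun _ _ => dist_nonneg
  · exact le_rfl

theorem exists_connectionCost_eq {F : Finset X} (hF : F.Nonempty) (j : X) :
    ∃ x ∈ F, connectionCost F j = dist x j := by
  rw [connectionCost, dif_pos hF]
  exact exists_mem_eq_inf' hF _

theorem IsLocalOpt.cost_le_of_exchange [DecidableEq X] {I : RedBlueMedian X} {p : ℕ}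
    {R B R' B' : Finset X} (h : I.IsLocalOpt p R B) (h' : (R', B') ∈ I.feasible)
    (A : Finset (Tagged fun c => bif c then R else B))
    (N : Finset (Tagged fun c => bif c then R' else B'))
    (hcard : ∀ c, (N.filter (·.1 = c)).card ≤ (A.filter (·.1 = c)).card) (hA : A.card ≤ p)
    (τ : X → X) (hτ : ∀ j, (∃ s, s ∉ A ∧ s.loc = τ j) ∨ ∃ o ∈ N, o.loc = τ j) :
    I.cost (R ∪ B) ≤ ∑ j ∈ I.clients, dist (τ j) j := by
  obtain ⟨hf, hloc⟩ := h
  simp only [feasible, mem_product, mem_powersetCard] at hf h'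
  have hcard' : ∀ c, (Tagged.part N c).card ≤ (Tagged.part A c).card := fun c => by
    rw [Tagged.card_part, Tagged.card_part]
    exact hcard c
  have hAp : ∀ c, (Tagged.part A c).card ≤ p := fun c => by
    rw [Tagged.card_part]
    exact (card_filter_le _ _).trans hA
  obtain ⟨R₁, hR1, hR2, hR3, hR4, hR5⟩ := exists_completed_swap hf.1.1
    (Tagged.part_subset A true) ((Tagged.part_subset N true).trans h'.1.1) (hcard' true)
  obtain ⟨B₁, hB1, hB2, hB3, hB4, hB5⟩ := exists_completed_swap hf.2.1
    (Tagged.part_subset A false) ((Tagged.part_subset N false).trans h'.2.1) (hcard' false)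
  have hle := hloc R₁ B₁
    (by
      simp only [feasible, mem_product, mem_powersetCard]
      exact ⟨⟨hR1, hR2.trans hf.1.2⟩, hB1, hB2.trans hf.2.2⟩)
    ((card_le_card hR3).trans (hAp true)) ((card_le_card hB3).trans (hAp false))
  refine (not_lt.1 hle).trans (sum_le_sum fun j _ => connectionCost_le ?_ j)
  rw [mem_union]
  rcases hτ j with ⟨s, hs, hsj⟩ | ⟨o, ho, hoj⟩
  · rw [← hsj]
    have hs' := mt Tagged.mem_part.1 hs
    obtain ⟨c, x⟩ := s
    cases c
    · exact Or.inr (hB4 (mem_sdiff.2 ⟨x.2, hs'⟩))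
    · exact Or.inl (hR4 (mem_sdiff.2 ⟨x.2, hs'⟩))
  · rw [← hoj]
    have ho' := Tagged.mem_part.2 ho
    obtain ⟨c, x⟩ := o
    cases c
    · exact Or.inr (hB5 ho')
    · exact Or.inl (hR5 ho')

end RedBlueMedian

/-! ### Weighted families of exchanges -/

/-- A weighted family of exchanges whose inequalities add up to the approximation guarantee.
There are `k` exchanges of weight `1`, the `i`-th one closing `out i` and opening `inn i`, and
exchanges of weight `wt z o`, which close a single `z` to which no `o'` is attached and open `o`.
In units of `1 / k`, every `o` is opened at least about once and every `a` is closed at most about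
twice. This must hold even after allowance for the exchanges in which `a` and `φ o` are closed and
`o` is not opened, where a client served by `a` and `o` is rerouted to `cent (φ o)`: their number is
added to the requirement on `o` and to the load of `a`. -/
structure SwapPlan {S O : Type*} [Fintype S] [Fintype O] [DecidableEq S] [DecidableEq O]
    (colS : S → Bool) (colO : O → Bool) (φ : O → S) (cent : S → O) (k M : ℕ) where
  /-- the facilities closed by the exchanges of weight `1` -/
  out : Fin k → Finset S
  /-- the facilities opened by the exchanges of weight `1` -/
  inn : Fin k → Finset O
  /-- the weight of the exchange of two single facilities -/
  wt : S → O → ℝ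
  card_le : ∀ i c, ((inn i).filter (colO · = c)).card ≤ ((out i).filter (colS · = c)).card
  fiber_le : ∀ i, ∀ s ∈ out i, ((inn i).filter (φ · = s)).card ≤ M
  cent_mem : ∀ i o, φ o ∈ out i → cent (φ o) ∈ inn i
  wt_nonneg : ∀ z o, 0 ≤ wt z o
  of_wt_ne : ∀ z o, wt z o ≠ 0 → colS z = colO o ∧ ∀ o', φ o' ≠ z
  le_in_weight : ∀ a o,
    (k : ℝ) + (univ.filter fun i => a ∈ out i ∧ φ o ∈ out i ∧ o ∉ inn i).card - 2 ≤
      (univ.filter fun i => o ∈ inn i).card + ∑ z, wt z o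
  out_weight_le : ∀ a o, ((univ.filter fun i => a ∈ out i).card : ℝ) + ∑ o', wt a o' +
    (univ.filter fun i => a ∈ out i ∧ φ o ∈ out i ∧ o ∉ inn i).card ≤ 2 * k + 5

theorem SwapPlan.sum_dist_le {X S O : Type*} [PseudoMetricSpace X] [Fintype S] [Fintype O]
    [DecidableEq S] [DecidableEq O] (clients : Finset X) (pS : S → X) (pO : O → X)
    {colS : S → Bool} {colO : O → Bool} (σ : X → S) (σ' : X → O) {φ : O → S} {cent : S → O}
    {p k M : ℕ} (P : SwapPlan colS colO φ cent k M)
    (hφ : ∀ o s, dist (pO o) (pS (φ o)) ≤ dist (pO o) (pS s))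
    (hcent : ∀ o, dist (pS (φ o)) (pO (cent (φ o))) ≤ dist (pS (φ o)) (pO o))
    (hswap : ∀ (A : Finset S) (I : Finset O),
      (∀ c, (I.filter (colO · = c)).card ≤ (A.filter (colS · = c)).card) → A.card ≤ p →
      ∀ τ : X → X, (∀ j, (∃ s, s ∉ A ∧ pS s = τ j) ∨ ∃ o ∈ I, pO o = τ j) →
        ∑ j ∈ clients, dist (pS (σ j)) j ≤ ∑ j ∈ clients, dist (τ j) j)
    (hk : 2 ≤ k) (hM : 1 ≤ M) (hp : (8 * M + 1) ^ 2 ≤ p) (hφcent : ∀ o, φ (cent (φ o)) = φ o) :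
    ((k : ℝ) - 2) * ∑ j ∈ clients, dist (pS (σ j)) j ≤
      (5 * k + 8) * ∑ j ∈ clients, dist (pO (σ' j)) j := by
  let m : X → ℝ := fun j => min 0 (dist (pO (σ' j)) j - dist (pS (σ j)) j)
  have hlayer := sum_nonneg fun i (_ : i ∈ univ) =>
    exchange_inequality clients pS pO colS colO σ σ' φ cent p M hφ hcent hswap hM hp
      (P.out i) (P.inn i) (P.card_le i) (P.fiber_le i) (P.cent_mem i) hφcent
  have hpair : ∀ z o, 0 ≤ P.wt z o * ∑ j ∈ clients,
      ((if o = σ' j then m j else 0) + if z = σ j then 2 * dist (pO (σ' j)) j else 0) := by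
    intro z o
    by_cases h0 : P.wt z o = 0
    · rw [h0, zero_mul]
    refine mul_nonneg (P.wt_nonneg z o) ?_
    obtain ⟨hc, hz⟩ := P.of_wt_ne z o h0
    have := exchange_inequality clients pS pO colS colO σ σ' φ cent p M hφ hcent hswap hM hp
      {z} {o} (fun c => by rw [filter_singleton, filter_singleton, hc]; split_ifs <;> simp)
      (fun s hs => by
        rw [mem_singleton] at hs
        rw [hs, filter_singleton, if_neg (hz o)]
        simp)
      (fun o' ho' => absurd (mem_singleton.1 ho') (hz o')) hφcent
    refine this.trans_eq (sum_congr rfl fun j _ => ?_)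
    simp only [mem_singleton, hz, false_and, if_false, add_zero, m, eq_comm]
  have hpairs := sum_nonneg fun z (_ : z ∈ univ) => sum_nonneg fun o (_ : o ∈ univ) => hpair z o
  have hclient : ∀ j ∈ clients,
      (∑ i, ((if σ' j ∈ P.inn i then m j else 0) +
        if σ j ∈ P.out i then 2 * dist (pO (σ' j)) j +
          (if φ (σ' j) ∈ P.out i ∧ σ' j ∉ P.inn i then dist (pO (σ' j)) j + dist (pS (σ j)) j
            else 0)
        else 0)) +
      (∑ z, ∑ o, P.wt z o * ((if o = σ' j then m j else 0) +
        if z = σ j then 2 * dist (pO (σ' j)) j else 0)) ≤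
      (5 * k + 8) * dist (pO (σ' j)) j - (k - 2) * dist (pS (σ j)) j := by
    intro j _
    have e1 : (∑ i, ((if σ' j ∈ P.inn i then m j else 0) +
        if σ j ∈ P.out i then 2 * dist (pO (σ' j)) j +
          (if φ (σ' j) ∈ P.out i ∧ σ' j ∉ P.inn i then dist (pO (σ' j)) j + dist (pS (σ j)) j
            else 0)
        else 0)) =
        (univ.filter fun i => σ' j ∈ P.inn i).card * m j +
        (univ.filter fun i => σ j ∈ P.out i).card * (2 * dist (pO (σ' j)) j) +
        (univ.filter fun i => σ j ∈ P.out i ∧ φ (σ' j) ∈ P.out i ∧ σ' j ∉ P.inn i).card *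
          (dist (pO (σ' j)) j + dist (pS (σ j)) j) := by
      simp only [← nsmul_eq_mul, ← sum_const, sum_filter, ← sum_add_distrib]
      refine sum_congr rfl fun i _ => ?_
      by_cases h : σ j ∈ P.out i <;> simp [h, add_assoc]
    have e2 : (∑ z, ∑ o, P.wt z o * ((if o = σ' j then m j else 0) +
        if z = σ j then 2 * dist (pO (σ' j)) j else 0)) =
        (∑ z, P.wt z (σ' j)) * m j + (∑ o, P.wt (σ j) o) * (2 * dist (pO (σ' j)) j) := by
      simp only [mul_add, sum_add_distrib, mul_ite, mul_zero, sum_ite_eq', mem_univ, if_true,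
        sum_mul]
      congr 1
      rw [sum_comm]
      simp only [sum_ite_eq', mem_univ, if_true]
    rw [e1, e2]
    have hin := P.le_in_weight (σ j) (σ' j)
    have hout := P.out_weight_le (σ j) (σ' j)
    have hx : 0 ≤ dist (pS (σ j)) j := dist_nonneg
    have hy : 0 ≤ dist (pO (σ' j)) j := dist_nonneg
    have hm0 : m j ≤ 0 := min_le_left _ _
    have hm1 : m j ≤ dist (pO (σ' j)) j - dist (pS (σ j)) j := min_le_right _ _
    have hb : (0 : ℝ) ≤ ((univ.filter fun i =>
      σ j ∈ P.out i ∧ φ (σ' j) ∈ P.out i ∧ σ' j ∉ P.inn i).card : ℝ) := by positivity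
    have hk' : (2 : ℝ) ≤ k := by exact_mod_cast hk
    generalize ((univ.filter fun i =>
      σ j ∈ P.out i ∧ φ (σ' j) ∈ P.out i ∧ σ' j ∉ P.inn i).card : ℝ) = b at *
    generalize ((univ.filter fun i => σ' j ∈ P.inn i).card : ℝ) = x₁ at *
    generalize ((univ.filter fun i => σ j ∈ P.out i).card : ℝ) = y₁ at *
    generalize (∑ z, P.wt z (σ' j)) = x₂ at *
    generalize (∑ o, P.wt (σ j) o) = y₂ at *
    generalize dist (pS (σ j)) j = c at *
    generalize dist (pO (σ' j)) j = c' at *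
    -- opening `o` has weight at least `k + b - 2`, and both bounds on `m j` apply
    have h1 : (x₁ + x₂) * m j ≤ (k + b - 2) * m j := mul_le_mul_of_nonpos_right hin hm0
    have h2 : (k + b - 2) * m j ≤ (k + b - 2) * (c' - c) :=
      mul_le_mul_of_nonneg_left hm1 (by linarith)
    have h3 : (y₁ + y₂ + b) * (2 * c') ≤ (2 * k + 5) * (2 * c') :=
      mul_le_mul_of_nonneg_right hout (by linarith)
    linarith
  have hfin := sum_le_sum hclient
  rw [sum_add_distrib, sum_sub_distrib, ← mul_sum, ← mul_sum] at hfin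
  rw [sum_comm] at hlayer
  have hpairs' : 0 ≤ ∑ j ∈ clients, ∑ z, ∑ o, P.wt z o * ((if o = σ' j then m j else 0) +
      if z = σ j then 2 * dist (pO (σ' j)) j else 0) := by
    rw [sum_comm]
    refine hpairs.trans_eq (sum_congr rfl fun z _ => ?_)
    rw [sum_comm]
    exact sum_congr rfl fun o _ => by rw [mul_sum]
  linarith

/-! ### Construction of the exchanges -/

theorem exists_disjoint_family {α : Type*} [DecidableEq α] {N : Finset α} {k d : ℕ}
    (h : k * d ≤ N.card) :
    ∃ D : Fin k → Finset α, (∀ i, D i ⊆ N) ∧ (∀ i, (D i).card = d) ∧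
      ∀ i j x, x ∈ D i → x ∈ D j → i = j := by
  obtain ⟨e⟩ : Nonempty (Fin k × Fin d ↪ N) :=
    Function.Embedding.nonempty_of_card_le (by simpa using h)
  refine ⟨fun i => univ.image fun y => (e (i, y) : α), fun i x hx => ?_, fun i => ?_,
    fun i j x hi hj => ?_⟩
  · obtain ⟨y, -, rfl⟩ := mem_image.1 hx
    exact (e (i, y)).2
  · rw [card_image_of_injective _ fun y y' hy => ?_, card_univ, Fintype.card_fin]
    exact (Prod.mk.inj (e.injective (Subtype.ext hy))).2
  · obtain ⟨y, -, hy⟩ := mem_image.1 hi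
    obtain ⟨y', -, hy'⟩ := mem_image.1 hj
    exact (Prod.mk.inj (e.injective (Subtype.ext (hy.trans hy'.symm)))).1

theorem Bool.eq_or_eq_of_ne {c d : Bool} (h : c ≠ d) (b : Bool) : b = c ∨ b = d := by
  cases b <;> cases c <;> cases d <;> simp_all

/-- An exchange `A₀`, `I₀` that opens slightly too many facilities becomes balanced in `k` ways by
not opening a few of them, so that no `o` is left out in more than one of the `k` ways. A facility
`o ≠ cent (φ o)` can be left out as it is. If there are too few of these in the colour `β`, the
pairs `s`, `cent s` of colours `ρ` and `β` are left out, each together with some `o ≠ cent (φ o)` of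
colour `ρ`. -/
theorem exists_balanced_exchanges {S O : Type*} [DecidableEq S] [DecidableEq O]
    (colS : S → Bool) (colO : O → Bool) (φ : O → S) (cent : S → O)
    (hφcent : ∀ o, φ (cent (φ o)) = φ o) {β ρ : Bool} (hβρ : β ≠ ρ)
    {k M dρ dβ : ℕ} {A₀ : Finset S} {I₀ Nρ Nβ : Finset O} {K : Finset S}
    (hρ : (I₀.filter (colO · = ρ)).card ≤ (A₀.filter (colS · = ρ)).card + dρ)
    (hβ : (I₀.filter (colO · = β)).card ≤ (A₀.filter (colS · = β)).card + dβ)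
    (hNρ : ∀ o ∈ Nρ, o ∈ I₀ ∧ colO o = ρ ∧ cent (φ o) ≠ o)
    (hNβ : ∀ o ∈ Nβ, o ∈ I₀ ∧ colO o = β ∧ cent (φ o) ≠ o)
    (hK : ∀ s ∈ K, colS s = ρ ∧ colO (cent s) = β ∧ φ (cent s) = s ∧ cent s ∈ I₀)
    (hnum : (k * dρ ≤ Nρ.card ∧ k * dβ ≤ Nβ.card) ∨
      (k * (dρ + dβ) ≤ Nρ.card ∧ k * dβ ≤ K.card))
    (hfib : ∀ s ∈ A₀, (I₀.filter (φ · = s)).card ≤ M)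
    (hmem : ∀ o, φ o ∈ A₀ → cent (φ o) ∈ I₀) :
    ∃ (out : Fin k → Finset S) (inn : Fin k → Finset O),
      (∀ i, out i ⊆ A₀) ∧ (∀ i, inn i ⊆ I₀) ∧
      (∀ i c, ((inn i).filter (colO · = c)).card ≤ ((out i).filter (colS · = c)).card) ∧
      (∀ i, ∀ s ∈ out i, ((inn i).filter (φ · = s)).card ≤ M) ∧
      (∀ i o, φ o ∈ out i → cent (φ o) ∈ inn i) ∧
      ∀ o ∈ I₀, (univ.filter fun i => o ∉ inn i).card ≤ 1 := by
  obtain ⟨f, hf, h1, h2, h3⟩ : ∃ f ≤ dβ, k * (dρ + f) ≤ Nρ.card ∧ k * (dβ - f) ≤ Nβ.card ∧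
      k * f ≤ K.card := by
    rcases hnum with h | h
    · exact ⟨0, Nat.zero_le _, h.1, h.2, by simp⟩
    · exact ⟨dβ, le_rfl, h.1, by simp, h.2⟩
  obtain ⟨Dρ, hDρ, hDρc, hDρd⟩ := exists_disjoint_family h1
  obtain ⟨Dβ, hDβ, hDβc, hDβd⟩ := exists_disjoint_family h2
  obtain ⟨F, hF, hFc, hFd⟩ := exists_disjoint_family h3
  have hcentF : ∀ i, ∀ o ∈ (F i).image cent, φ o ∈ F i ∧ cent (φ o) = o ∧ o ∈ I₀ ∧ colO o = β := by
    intro i o ho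
    obtain ⟨s, hs, rfl⟩ := mem_image.1 ho
    obtain ⟨-, e1, e2, e3⟩ := hK s (hF i hs)
    rw [e2]
    exact ⟨hs, rfl, e3, e1⟩
  have hcentFc : ∀ i, ((F i).image cent).card = f := by
    intro i
    rw [card_image_of_injOn, hFc]
    intro s hs s' hs' h
    rw [← (hK s (hF i hs)).2.2.1, ← (hK s' (hF i hs')).2.2.1, h]
  refine ⟨fun i => A₀ \ F i, fun i => I₀ \ (Dρ i ∪ (Dβ i ∪ (F i).image cent)),
    fun i => sdiff_subset, fun i => sdiff_subset, fun i c => ?_, fun i s hs => ?_,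
    fun i o ho => ?_, fun o ho => ?_⟩
  · obtain rfl | rfl := Bool.eq_or_eq_of_ne hβρ c
    · have e1 : ((I₀ \ (Dρ i ∪ (Dβ i ∪ (F i).image cent))).filter (colO · = c)).card +
          (Dβ i ∪ (F i).image cent).card ≤ (I₀.filter (colO · = c)).card := by
        rw [← card_union_of_disjoint]
        · refine card_le_card (union_subset (filter_subset_filter _ sdiff_subset) fun o ho => ?_)
          rw [mem_filter]
          rcases mem_union.1 ho with ho | ho
          · exact ⟨(hNβ o (hDβ i ho)).1, (hNβ o (hDβ i ho)).2.1⟩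
          · exact ⟨(hcentF i o ho).2.2.1, (hcentF i o ho).2.2.2⟩
        · rw [disjoint_left]
          intro o ho ho'
          rw [mem_filter, mem_sdiff] at ho
          exact ho.1.2 (mem_union_right _ ho')
      have e2 : (Dβ i ∪ (F i).image cent).card = dβ - f + f := by
        rw [card_union_of_disjoint, hDβc, hcentFc]
        rw [disjoint_left]
        intro o ho ho'
        exact (hNβ o (hDβ i ho)).2.2 (hcentF i o ho').2.1
      have e3 : (A₀.filter (colS · = c)).card ≤ ((A₀ \ F i).filter (colS · = c)).card := by
        refine card_le_card fun s hs => ?_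
        rw [mem_filter] at hs
        rw [mem_filter, mem_sdiff]
        refine ⟨⟨hs.1, fun h => hβρ ?_⟩, hs.2⟩
        rw [← hs.2, (hK s (hF i h)).1]
      beta_reduce
      omega
    · have e1 : ((I₀ \ (Dρ i ∪ (Dβ i ∪ (F i).image cent))).filter (colO · = c)).card +
          (Dρ i).card ≤ (I₀.filter (colO · = c)).card := by
        rw [← card_union_of_disjoint]
        · refine card_le_card (union_subset (filter_subset_filter _ sdiff_subset) fun o ho => ?_)
          rw [mem_filter]
          exact ⟨(hNρ o (hDρ i ho)).1, (hNρ o (hDρ i ho)).2.1⟩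
        · rw [disjoint_left]
          intro o ho ho'
          rw [mem_filter, mem_sdiff] at ho
          exact ho.1.2 (mem_union_left _ ho')
      have e2 : (A₀.filter (colS · = c)).card ≤
          ((A₀ \ F i).filter (colS · = c)).card + (F i).card := by
        refine (card_le_card fun s hs => ?_).trans (card_union_le _ _)
        rw [mem_filter] at hs
        rw [mem_union, mem_filter, mem_sdiff]
        tauto
      rw [hDρc] at e1
      rw [hFc] at e2
      beta_reduce
      omega
  · exact (card_le_card (filter_subset_filter _ sdiff_subset)).trans
      (hfib s (mem_sdiff.1 hs).1)
  · rw [mem_sdiff] at ho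
    refine mem_sdiff.2 ⟨hmem o ho.1, fun h => ?_⟩
    rcases mem_union.1 h with h | h
    · exact (hNρ _ (hDρ i h)).2.2 (by rw [hφcent])
    rcases mem_union.1 h with h | h
    · exact (hNβ _ (hDβ i h)).2.2 (by rw [hφcent])
    · have := (hcentF i _ h).1
      rw [hφcent] at this
      exact ho.2 this
  · rw [card_le_one]
    intro i hi j hj
    simp only [mem_filter, mem_univ, true_and, mem_sdiff, ho, not_not, mem_union] at hi hj
    have hD : ∀ i, o ∈ Dρ i → colO o = ρ ∧ cent (φ o) ≠ o := fun i h => (hNρ o (hDρ i h)).2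
    have hD' : ∀ i, o ∈ Dβ i → colO o = β ∧ cent (φ o) ≠ o := fun i h => (hNβ o (hDβ i h)).2
    rcases hi with hi | hi | hi <;> rcases hj with hj | hj | hj
    · exact hDρd i j o hi hj
    · exact absurd ((hD' _ hj).1.symm.trans (hD _ hi).1) hβρ
    · exact absurd (hcentF j o hj).2.1 (hD _ hi).2
    · exact absurd ((hD' _ hi).1.symm.trans (hD _ hj).1) hβρ
    · exact hDβd i j o hi hj
    · exact absurd (hcentF j o hj).2.1 (hD' _ hi).2
    · exact absurd (hcentF i o hi).2.1 (hD _ hj).2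
    · exact absurd (hcentF i o hi).2.1 (hD' _ hj).2
    · exact hFd i j (φ o) (hcentF i o hi).1 (hcentF j o hj).1

theorem mul_card_le_card_filter_ne {S O : Type*} [DecidableEq S] [DecidableEq O]
    (φ : O → S) (cent : S → O) {t : ℕ} (W : Finset S) (T : Finset O)
    (hW : ∀ s ∈ W, t < (T.filter (φ · = s)).card) :
    t * W.card ≤ (T.filter fun o => cent (φ o) ≠ o ∧ φ o ∈ W).card := by
  rw [card_eq_sum_card_fiberwise (f := φ) (t := W) fun o ho => (mem_filter.1 ho).2.2, mul_comm,
    ← smul_eq_mul]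
  refine card_nsmul_le_sum _ _ _ fun s hs => ?_
  have : (T.filter (φ · = s)).card - 1 ≤
      ((T.filter fun o => cent (φ o) ≠ o ∧ φ o ∈ W).filter (φ · = s)).card := by
    refine (pred_card_le_card_erase (a := cent s)).trans (card_le_card fun o ho => ?_)
    rw [mem_erase, mem_filter] at ho
    obtain ⟨h1, h2, rfl⟩ := ho
    simp only [mem_filter, h2, hs, true_and, and_true]
    exact Ne.symm h1
  have := hW s hs
  omega


section

variable {S O : Type*} [Fintype S] [Fintype O] [DecidableEq S]
  (colS : S → Bool) (colO : O → Bool) (φ : O → S) (cent : S → O)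

/-- The facilities of the local optimum of colour `c` to which nothing is attached, where `o` counts
as attached to `φ o`. -/
def lonely (c : Bool) : Finset S := univ.filter fun s => (∀ o, φ o ≠ s) ∧ colS s = c

/-- The facilities `s` of the local optimum of colour `c` to which something is attached and for
which `cent s` has colour `d`. -/
def crossing (c d : Bool) : Finset S :=
  univ.filter fun s => φ (cent s) = s ∧ colS s = c ∧ colO (cent s) = d

/-- The facilities of the local optimum to which more than `t` facilities are attached. -/
def heavy (t : ℕ) : Finset S := univ.filter fun s => t < (univ.filter (φ · = s)).card

theorem card_heavy_add {β ρ : Bool} (hβρ : β ≠ ρ) (t : ℕ) :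
    ((heavy φ t).filter (colS · = ρ)).card + ((heavy φ t).filter (colS · = β)).card =
      (heavy φ t).card := by
  rw [← card_union_of_disjoint, ← filter_or]
  · congr 1
    exact filter_true_of_mem fun s _ => (Bool.eq_or_eq_of_ne hβρ (colS s)).symm
  · rw [disjoint_left]
    intro s hs hs'
    exact hβρ ((mem_filter.1 hs').2.symm.trans (mem_filter.1 hs).2)

variable [DecidableEq O]

/-- The facilities `o` of the optimum of colour `c` other than `cent (φ o)`. -/
def noncentral (c : Bool) : Finset O := univ.filter fun o => cent (φ o) ≠ o ∧ colO o = c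

/-- Both sides count, up to the `s` of colour `c` for which `cent s` has colour `c` too, the
facilities of colour `c`: those of the local optimum on the left, those of the optimum on the
right. -/
theorem card_lonely_add (hcol : ∀ c, (univ.filter (colS · = c)).card =
      (univ.filter (colO · = c)).card)
    (hφcent : ∀ o, φ (cent (φ o)) = φ o) {c d : Bool} (hcd : c ≠ d) :
    (lonely colS φ c).card + (crossing colS colO φ cent c d).card =
      (noncentral colO φ cent c).card + (crossing colS colO φ cent d c).card := by
  simp only [lonely, crossing, noncentral]
  have hcases := Bool.eq_or_eq_of_ne hcd
  have hlon : ∀ s, (∀ o, φ o ≠ s) ↔ φ (cent s) ≠ s := fun s =>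
    ⟨fun h => h _, fun h o ho => h (by rw [← ho, hφcent])⟩
  have h1 : (univ.filter (colS · = c)).card =
      (univ.filter fun s => (∀ o, φ o ≠ s) ∧ colS s = c).card +
      (univ.filter fun s => φ (cent s) = s ∧ colS s = c ∧ colO (cent s) = d).card +
      (univ.filter fun s => φ (cent s) = s ∧ colS s = c ∧ colO (cent s) = c).card := by
    rw [← card_union_of_disjoint, ← card_union_of_disjoint]
    · congr 1
      ext s
      simp only [mem_filter, mem_univ, true_and, mem_union, hlon]
      have := hcases (colO (cent s))
      tauto
    · rw [disjoint_left]
      intro s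
      simp only [mem_filter, mem_univ, true_and, mem_union, hlon]
      rintro (⟨h, -⟩ | ⟨-, -, h⟩) ⟨h', -, h''⟩
      · exact h h'
      · exact hcd (h''.symm.trans h)
    · rw [disjoint_left]
      intro s
      simp only [mem_filter, mem_univ, true_and, hlon]
      tauto
  have h2 : (univ.filter (colO · = c)).card =
      (univ.filter fun o => cent (φ o) ≠ o ∧ colO o = c).card +
      ((univ.filter fun s => φ (cent s) = s ∧ colS s = d ∧ colO (cent s) = c).card +
      (univ.filter fun s => φ (cent s) = s ∧ colS s = c ∧ colO (cent s) = c).card) := by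
    rw [← card_union_of_disjoint (s := univ.filter fun s =>
      φ (cent s) = s ∧ colS s = d ∧ colO (cent s) = c)]
    · rw [← card_image_of_injOn (f := cent), ← card_union_of_disjoint]
      · congr 1
        ext o
        simp only [mem_filter, mem_univ, true_and, mem_union, mem_image]
        constructor
        · intro ho
          by_cases h : cent (φ o) = o
          · refine Or.inr ⟨φ o, ?_, h⟩
            have := hcases (colS (φ o))
            rw [h]
            tauto
          · exact Or.inl ⟨h, ho⟩
        · rintro (⟨-, h⟩ | ⟨s, h, rfl⟩)
          · exact h
          · tauto
      · rw [disjoint_left]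
        intro o
        simp only [mem_filter, mem_univ, true_and, mem_union, mem_image]
        rintro ⟨h, -⟩ ⟨s, hs, rfl⟩
        have : φ (cent s) = s := by tauto
        exact h (by rw [this])
      · intro s hs s' hs' h
        simp only [coe_union, coe_filter, mem_univ, true_and, Set.mem_union] at hs hs'
        have e1 : φ (cent s) = s := hs.elim And.left And.left
        have e2 : φ (cent s') = s' := hs'.elim And.left And.left
        rw [← e1, ← e2, h]
    · rw [disjoint_left]
      intro s
      simp only [mem_filter, mem_univ, true_and]
      rintro ⟨-, h, -⟩ ⟨-, h', -⟩
      exact hcd (h'.symm.trans h)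
  have := hcol c
  omega

theorem mul_card_heavy_le {β ρ : Bool} (hβρ : β ≠ ρ) (t : ℕ) :
    t * (heavy φ t).card ≤
      (noncentral colO φ cent ρ).card + (noncentral colO φ cent β).card := by
  have h := mul_card_le_card_filter_ne φ cent (heavy φ t) univ fun s hs => (mem_filter.1 hs).2
  refine h.trans ((card_le_card fun o ho => ?_).trans (card_union_le _ _))
  have h1 := (mem_filter.1 ho).2.1
  rw [mem_union, noncentral, noncentral, mem_filter, mem_filter]
  exact (Bool.eq_or_eq_of_ne hβρ (colO o)).symm.imp (fun h => ⟨mem_univ _, h1, h⟩)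
    fun h => ⟨mem_univ _, h1, h⟩

end

theorem card_filter_fin_le {k : ℕ} (q : Fin k → Prop) [DecidablePred q] :
    (univ.filter q).card ≤ k :=
  (card_le_univ _).trans_eq (Fintype.card_fin k)

theorem le_card_filter_add_one {k : ℕ} {q r : Fin k → Prop} [DecidablePred q] [DecidablePred r]
    (h : (univ.filter fun i => ¬q i).card ≤ 1) (hr : ∀ i, r i → ¬q i) :
    ((univ.filter r).card : ℝ) ≤ 1 ∧ (k : ℝ) ≤ (univ.filter q).card + 1 := by
  have h2 := card_filter_add_card_filter_not (s := (univ : Finset (Fin k))) q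
  rw [card_univ, Fintype.card_fin] at h2
  constructor
  · exact_mod_cast (card_le_card (monotone_filter_right _ fun i _ => hr i)).trans h
  · have : k ≤ (univ.filter q).card + 1 := by omega
    exact_mod_cast this

/-- The case in which closing no heavy facility is affordable. Its loss in the colour `ρ` is covered
by lonely facilities of colour `ρ`, which are closed in total weight at most `2`, and its loss in
the colour `β`, of which there are many lonely facilities, by leaving out a fraction `1 / k` of the
optimum. -/
theorem exists_swapPlan_of_card_heavy_le
    {S O : Type*} [Fintype S] [Fintype O] [DecidableEq S] [DecidableEq O]
    (colS : S → Bool) (colO : O → Bool) (φ : O → S) (cent : S → O)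
    (hcol : ∀ c, (univ.filter (colS · = c)).card = (univ.filter (colO · = c)).card)
    (hφcent : ∀ o, φ (cent (φ o)) = φ o) {k : ℕ} (hk : 2 ≤ k) {β ρ : Bool} (hβρ : β ≠ ρ)
    (hle : (lonely colS φ ρ).card ≤ (lonely colS φ β).card)
    (hcase : ((heavy φ (6 * k)).filter (colS · = ρ)).card ≤ (crossing colS colO φ cent β ρ).card ∧
      ((heavy φ (6 * k)).filter (colS · = ρ)).card ≤ (lonely colS φ ρ).card) :
    Nonempty (SwapPlan colS colO φ cent k (6 * k + 1)) := by
  have hid1 := card_lonely_add colS colO φ cent hcol hφcent hβρ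
  have hid2 := card_lonely_add colS colO φ cent hcol hφcent hβρ.symm
  have hheavy := card_heavy_add colS φ hβρ (6 * k)
  have hnc := mul_card_heavy_le colO φ cent hβρ (6 * k)
  rw [mul_assoc] at hnc
  have hk' : (2 : ℝ) ≤ k := by exact_mod_cast hk
  -- the facilities `cent s`, `s ∈ E`, of colour `ρ` are opened in separate exchanges
  obtain ⟨E, hE, hEc⟩ := exists_subset_card_eq hcase.1
  have hE' : ∀ s ∈ E, φ (cent s) = s ∧ colS s = β ∧ colO (cent s) = ρ := fun s hs =>
    (mem_filter.1 (hE hs)).2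
  have hC : ∀ o ∈ E.image cent, φ o ∈ E ∧ cent (φ o) = o ∧ colO o = ρ := by
    intro o ho
    obtain ⟨s, hs, rfl⟩ := mem_image.1 ho
    obtain ⟨h1, -, h2⟩ := hE' s hs
    rw [h1]
    exact ⟨hs, rfl, h2⟩
  have hCc : (E.image cent).card = E.card := by
    refine card_image_of_injOn fun s hs s' hs' h => ?_
    rw [← (hE' s hs).1, ← (hE' s' hs').1, h]
  obtain ⟨e⟩ : Nonempty (E.image cent ↪ lonely colS φ ρ) :=
    Function.Embedding.nonempty_of_card_le (by
      rw [Fintype.card_coe, Fintype.card_coe, hCc, hEc]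
      exact hcase.2)
  obtain ⟨out, inn, hout, -, h3, h4, h5, h6⟩ := exists_balanced_exchanges colS colO φ cent hφcent
    hβρ (k := k) (M := 6 * k + 1) (dρ := 0) (dβ := (heavy φ (6 * k)).card)
    (A₀ := univ \ (heavy φ (6 * k) ∪ E)) (I₀ := univ \ E.image cent)
    (Nρ := noncentral colO φ cent ρ) (Nβ := noncentral colO φ cent β)
    (K := crossing colS colO φ cent ρ β)
    (by
      have e1 : (univ.filter (colS · = ρ)).card ≤
          ((univ \ (heavy φ (6 * k) ∪ E)).filter (colS · = ρ)).card +
            ((heavy φ (6 * k)).filter (colS · = ρ)).card := by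
        refine (card_le_card fun s hs => ?_).trans (card_union_le _ _)
        have hs' := (mem_filter.1 hs).2
        have : s ∉ E := fun h => hβρ ((hE' s h).2.1.symm.trans hs')
        simp only [mem_union, mem_filter, mem_sdiff, mem_univ, true_and, hs', this, and_true,
          or_false]
        exact (em (s ∈ heavy φ (6 * k))).symm
      have e2 : ((univ \ E.image cent).filter (colO · = ρ)).card + (E.image cent).card ≤
          (univ.filter (colO · = ρ)).card := by
        rw [← card_union_of_disjoint]
        · refine card_le_card (union_subset (filter_subset_filter _ sdiff_subset) fun o ho => ?_)
          exact mem_filter.2 ⟨mem_univ _, (hC o ho).2.2⟩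
        · rw [disjoint_left]
          intro o ho ho'
          exact (mem_sdiff.1 (mem_filter.1 ho).1).2 ho'
      have := hcol ρ
      omega)
    (by
      have e1 : (univ.filter (colS · = β)).card ≤
          ((univ \ (heavy φ (6 * k) ∪ E)).filter (colS · = β)).card +
            (((heavy φ (6 * k)).filter (colS · = β)).card + E.card) := by
        refine (card_le_card fun s hs => ?_).trans ((card_union_le _ _).trans
          (Nat.add_le_add_left (card_union_le _ _) _))
        have hs' := (mem_filter.1 hs).2
        simp only [mem_union, mem_filter, mem_sdiff, mem_univ, true_and, hs', and_true]
        exact (em (s ∈ heavy φ (6 * k) ∨ s ∈ E)).symm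
      have e2 : ((univ \ E.image cent).filter (colO · = β)).card ≤
          (univ.filter (colO · = β)).card :=
        card_le_card (filter_subset_filter _ sdiff_subset)
      have := hcol β
      omega)
    (fun o ho => by
      have ho' := (mem_filter.1 ho).2
      exact ⟨mem_sdiff.2 ⟨mem_univ _, fun h => ho'.1 (hC o h).2.1⟩, ho'.2, ho'.1⟩)
    (fun o ho => by
      have ho' := (mem_filter.1 ho).2
      exact ⟨mem_sdiff.2 ⟨mem_univ _, fun h => ho'.1 (hC o h).2.1⟩, ho'.2, ho'.1⟩)
    (fun s hs => by
      have hs' := (mem_filter.1 hs).2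
      refine ⟨hs'.2.1, hs'.2.2, hs'.1, mem_sdiff.2 ⟨mem_univ _, fun h => ?_⟩⟩
      exact hβρ (hs'.2.2.symm.trans (hC _ h).2.2))
    (by
      rw [zero_add, mul_zero]
      by_cases h : k * (heavy φ (6 * k)).card ≤ (noncentral colO φ cent β).card
      · exact Or.inl ⟨Nat.zero_le _, h⟩
      · exact Or.inr ⟨by omega, by omega⟩)
    (fun s hs => by
      have hs' : s ∉ heavy φ (6 * k) := fun h => (mem_sdiff.1 hs).2 (mem_union_left _ h)
      simp only [heavy, mem_filter, mem_univ, true_and, not_lt] at hs'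
      have := card_le_card (filter_subset_filter (φ · = s) (subset_univ (univ \ E.image cent)))
      omega)
    (fun o ho => by
      refine mem_sdiff.2 ⟨mem_univ _, fun h => ?_⟩
      have := (hC _ h).1
      rw [hφcent] at this
      exact (mem_sdiff.1 ho).2 (mem_union_right _ this))
  have hbad : ∀ a, ∀ o ∈ E.image cent,
      (univ.filter fun i => a ∈ out i ∧ φ o ∈ out i ∧ o ∉ inn i).card = 0 := by
    intro a o ho
    rw [card_eq_zero, filter_eq_empty_iff]
    rintro i - ⟨-, h, -⟩
    exact (mem_sdiff.1 (hout i h)).2 (mem_union_right _ (hC o ho).1)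
  let wt : S → O → ℝ := fun z o =>
    if h : o ∈ E.image cent then (if (e ⟨o, h⟩ : S) = z then (k : ℝ) else 0) else 0
  have hwt0 : ∀ z o, 0 ≤ wt z o := by
    intro z o
    simp only [wt]
    split_ifs <;> positivity
  have hwt1 : ∀ a, ∑ o, wt a o ≤ k := by
    intro a
    by_cases hex : ∃ o, wt a o ≠ 0
    · obtain ⟨o, ho⟩ := hex
      have hval : ∀ o', wt a o' ≠ 0 → ∃ h : o' ∈ E.image cent, (e ⟨o', h⟩ : S) = a := by
        intro o' ho'
        simp only [wt, ne_eq] at ho'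
        split_ifs at ho' with h1 h2
        · exact ⟨h1, h2⟩
        · exact absurd rfl ho'
        · exact absurd rfl ho'
      rw [sum_eq_single o]
      · simp only [wt]
        split_ifs
        · exact le_rfl
        · positivity
        · positivity
      · intro o' _ hne
        by_contra h'
        obtain ⟨h1, h2⟩ := hval o ho
        obtain ⟨h3, h4⟩ := hval o' h'
        have := e.injective (Subtype.ext (h4.trans h2.symm))
        exact hne (congrArg Subtype.val this)
      · exact fun h => absurd (mem_univ o) h
    · push Not at hex
      rw [sum_eq_zero fun o _ => hex o]
      positivity
  refine ⟨⟨out, inn, wt, h3, h4, h5, hwt0, fun z o h => ?_, fun a o => ?_, fun a o => ?_⟩⟩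
  · simp only [wt, ne_eq] at h
    split_ifs at h with h1 h2
    · have := (mem_filter.1 (e ⟨o, h1⟩).2).2
      rw [h2] at this
      exact ⟨this.2.trans (hC o h1).2.2.symm, this.1⟩
    · exact absurd rfl h
    · exact absurd rfl h
  · by_cases ho : o ∈ E.image cent
    · rw [hbad a o ho]
      have : ∑ z, wt z o = k := by
        simp only [wt, dif_pos ho, sum_ite_eq, mem_univ, if_true]
      rw [this]
      have : (0 : ℝ) ≤ (univ.filter fun i => o ∈ inn i).card := by positivity
      push_cast
      linarith
    · obtain ⟨h7, h8⟩ := le_card_filter_add_one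
        (r := fun i => a ∈ out i ∧ φ o ∈ out i ∧ o ∉ inn i)
        (h6 o (mem_sdiff.2 ⟨mem_univ _, ho⟩)) fun i h => h.2.2
      have h9 : 0 ≤ ∑ z, wt z o := sum_nonneg fun z _ => hwt0 z o
      linarith
  · have h7 : ((univ.filter fun i => a ∈ out i ∧ φ o ∈ out i ∧ o ∉ inn i).card : ℝ) ≤ 1 := by
      by_cases ho : o ∈ E.image cent
      · rw [hbad a o ho]
        simp
      · exact (le_card_filter_add_one (h6 o (mem_sdiff.2 ⟨mem_univ _, ho⟩)) fun i h => h.2.2).1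
    have h8 : ((univ.filter fun i => a ∈ out i).card : ℝ) ≤ k := by
      exact_mod_cast card_filter_fin_le _
    have := hwt1 a
    linarith

theorem mul_le_add_two_mul {k h z u n : ℕ} (hk : 2 * h ≤ k * h) (hz : 3 * (k * h) ≤ z)
    (hu : u ≤ z + h) (hn : (k * h ≤ u ∧ n = min z (u - h)) ∨ n = min z u) :
    k * u ≤ (k + 2) * n := by
  have e1 : k * u ≤ k * z + k * h := by
    rw [← mul_add]
    exact Nat.mul_le_mul_left _ hu
  rw [add_mul]
  rcases hn with ⟨h1, rfl⟩ | rfl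
  · have e2 : k * (u - h) + k * h = k * u := by
      rw [← mul_add, Nat.sub_add_cancel (by omega)]
    rcases le_total z (u - h) with h2 | h2
    · rw [min_eq_left h2]
      omega
    · rw [min_eq_right h2]
      omega
  · rcases le_total z u with h2 | h2
    · rw [min_eq_left h2]
      omega
    · rw [min_eq_right h2]
      omega

/-- The facilities `U`, of which nothing is required in the exchanges of weight `1`, are opened with
total weight `2` in exchanges that each close a single member of `Z`. -/
theorem exists_swapPlan_of_exchanges {S O : Type*} [Fintype S] [Fintype O] [DecidableEq S]
    [DecidableEq O] {colS : S → Bool} {colO : O → Bool} {φ : O → S} {cent : S → O} {k M : ℕ}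
    (hk : 2 ≤ k) (out : Fin k → Finset S) (inn : Fin k → Finset O)
    (hcard : ∀ i c, ((inn i).filter (colO · = c)).card ≤ ((out i).filter (colS · = c)).card)
    (hfib : ∀ i, ∀ s ∈ out i, ((inn i).filter (φ · = s)).card ≤ M)
    (hmem : ∀ i o, φ o ∈ out i → cent (φ o) ∈ inn i) {U : Finset O} {Z : Finset S}
    (hZ : ∀ z ∈ Z, ∀ o ∈ U, colS z = colO o ∧ ∀ o', φ o' ≠ z) (hZout : ∀ z ∈ Z, ∀ i, z ∉ out i)
    (hinn : ∀ o ∉ U, (univ.filter fun i => o ∉ inn i).card ≤ 1) (hne : U.Nonempty → Z.Nonempty)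
    (hratio : k * U.card ≤ (k + 2) * Z.card) : Nonempty (SwapPlan colS colO φ cent k M) := by
  have hk' : (2 : ℝ) ≤ k := by exact_mod_cast hk
  have hratio' : (k * U.card : ℝ) ≤ (k + 2) * Z.card := by exact_mod_cast hratio
  let wt : S → O → ℝ := fun z o => if z ∈ Z ∧ o ∈ U then 2 * k / Z.card else 0
  have hwt0 : ∀ z o, 0 ≤ wt z o := by
    intro z o
    simp only [wt]
    split_ifs <;> positivity
  refine ⟨⟨out, inn, wt, hcard, hfib, hmem, hwt0, fun z o h => ?_, fun a o => ?_, fun a o => ?_⟩⟩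
  · simp only [wt, ne_eq] at h
    split_ifs at h with h1
    · exact hZ z h1.1 o h1.2
    · exact absurd rfl h
  · by_cases ho : o ∈ U
    · have h7 : ∑ z, wt z o = 2 * k := by
        simp only [wt, ho, and_true]
        rw [← sum_filter, sum_const, nsmul_eq_mul, filter_mem_eq_inter, univ_inter]
        have : (0 : ℝ) < Z.card := by exact_mod_cast card_pos.2 (hne ⟨o, ho⟩)
        field_simp
      have h8 : ((univ.filter fun i => a ∈ out i ∧ φ o ∈ out i ∧ o ∉ inn i).card : ℝ) ≤ k := by
        exact_mod_cast card_filter_fin_le _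
      have : (0 : ℝ) ≤ (univ.filter fun i => o ∈ inn i).card := by positivity
      linarith
    · obtain ⟨h7, h8⟩ := le_card_filter_add_one
        (r := fun i => a ∈ out i ∧ φ o ∈ out i ∧ o ∉ inn i)
        (hinn o ho) fun i h => h.2.2
      have h9 : 0 ≤ ∑ z, wt z o := sum_nonneg fun z _ => hwt0 z o
      linarith
  · by_cases ha : a ∈ Z
    · simp only [hZout a ha, false_and, filter_false, card_empty, Nat.cast_zero, zero_add, add_zero]
      have : ∑ o, wt a o = U.card * (2 * k / Z.card) := by
        simp only [wt, ha, true_and]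
        rw [← sum_filter, sum_const, nsmul_eq_mul, filter_mem_eq_inter, univ_inter]
      rw [this]
      have hnpos : (0 : ℝ) < Z.card := by exact_mod_cast card_pos.2 ⟨a, ha⟩
      rw [mul_div_assoc', div_le_iff₀ hnpos]
      linarith
    · have h7 : ∑ o, wt a o = 0 := sum_eq_zero fun o _ => if_neg fun h => ha h.1
      have h8 : ((univ.filter fun i => a ∈ out i ∧ φ o ∈ out i ∧ o ∉ inn i).card : ℝ) ≤ k := by
        exact_mod_cast card_filter_fin_le _
      have h9 : ((univ.filter fun i => a ∈ out i).card : ℝ) ≤ k := by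
        exact_mod_cast card_filter_fin_le _
      linarith

/-- The remaining case. Most heavy facilities `s` of colour `ρ` are closed, together with the
opening of `cent s` and of the facilities of colour `ρ` attached to `s`. The other facilities `U` of
colour `β` attached to `s` cannot be opened at the same time. Opening them with weight `2` in other
exchanges outweighs the cost of rerouting their clients to `cent s`, and there are about as many
lonely facilities of colour `β` as members of `U` to pay for this. -/
theorem exists_swapPlan_of_lt_card_heavy
    {S O : Type*} [Fintype S] [Fintype O] [DecidableEq S] [DecidableEq O]
    (colS : S → Bool) (colO : O → Bool) (φ : O → S) (cent : S → O)
    (hcol : ∀ c, (univ.filter (colS · = c)).card = (univ.filter (colO · = c)).card)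
    (hφcent : ∀ o, φ (cent (φ o)) = φ o) {k : ℕ} (hk : 2 ≤ k) {β ρ : Bool} (hβρ : β ≠ ρ)
    (hle : (lonely colS φ ρ).card ≤ (lonely colS φ β).card)
    (hcase : ¬(((heavy φ (6 * k)).filter (colS · = ρ)).card ≤
      (crossing colS colO φ cent β ρ).card ∧
      ((heavy φ (6 * k)).filter (colS · = ρ)).card ≤ (lonely colS φ ρ).card)) :
    Nonempty (SwapPlan colS colO φ cent k (6 * k + 1)) := by
  have hid1 := card_lonely_add colS colO φ cent hcol hφcent hβρ
  have hid2 := card_lonely_add colS colO φ cent hcol hφcent hβρ.symm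
  have hheavy := card_heavy_add colS φ hβρ (6 * k)
  have hnc := mul_card_heavy_le colO φ cent hβρ (6 * k)
  rw [mul_assoc] at hnc
  have hkH2 : 2 * (heavy φ (6 * k)).card ≤ k * (heavy φ (6 * k)).card := Nat.mul_le_mul_right _ hk
  -- the members of `V'` have too many facilities of their own colour attached, and stay open;
  -- leaving out a fraction `1 / k` of the facilities of colour `ρ` makes up for it
  let V' : Finset S := (heavy φ (6 * k)).filter fun s =>
    colS s = ρ ∧ 6 * k < ((univ.filter (colO · = ρ)).filter (φ · = s)).card
  let U : Finset O := (noncentral colO φ cent β).filter fun o =>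
    φ o ∈ heavy φ (6 * k) ∧ colS (φ o) = ρ ∧ φ o ∉ V'
  have hV' : 6 * (k * V'.card) ≤ (noncentral colO φ cent ρ).card := by
    have h := mul_card_le_card_filter_ne φ cent V' (univ.filter (colO · = ρ))
      fun s hs => (mem_filter.1 hs).2.2
    rw [mul_assoc] at h
    refine h.trans (card_le_card fun o ho => ?_)
    rw [mem_filter, mem_filter] at ho
    exact mem_filter.2 ⟨mem_univ _, ho.2.1, ho.1.2⟩
  have hV'H : V'.card ≤ (heavy φ (6 * k)).card := card_le_card (filter_subset _ _)
  have hkV' : k * V'.card ≤ k * (heavy φ (6 * k)).card := Nat.mul_le_mul_left _ hV'H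
  have hH : 1 ≤ (heavy φ (6 * k)).card := by
    by_contra h
    exact hcase ⟨by omega, by omega⟩
  have hUnc : U.card ≤ (noncentral colO φ cent β).card := card_le_card (filter_subset _ _)
  have hUlon : U.card ≤ (lonely colS φ β).card + (heavy φ (6 * k)).card := by
    by_contra h
    exact hcase ⟨by omega, by omega⟩
  -- `n` lonely facilities of colour `β` are set aside to be closed for `U`; if `U` is large, the
  -- heavy facilities of colour `β`, which stay open, are made up for by setting aside fewer of
  -- them, and otherwise by leaving out a fraction `1 / k` of the optimum
  obtain ⟨n, dβ, hnd⟩ : ∃ n dβ, (k * (heavy φ (6 * k)).card ≤ U.card ∧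
        n = min (lonely colS φ β).card (U.card - (heavy φ (6 * k)).card) ∧ dβ = 0) ∨
      (U.card < k * (heavy φ (6 * k)).card ∧ n = min (lonely colS φ β).card U.card ∧
        dβ = (heavy φ (6 * k)).card) := by
    rcases le_or_gt (k * (heavy φ (6 * k)).card) U.card with h | h
    · exact ⟨_, _, Or.inl ⟨h, rfl, rfl⟩⟩
    · exact ⟨_, _, Or.inr ⟨h, rfl, rfl⟩⟩
  obtain ⟨Z, hZ, hZc⟩ := exists_subset_card_eq (s := lonely colS φ β) (n := n) (by omega)
  have hUmem : ∀ o ∈ U, (cent (φ o) ≠ o ∧ colO o = β) ∧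
      φ o ∈ heavy φ (6 * k) ∧ colS (φ o) = ρ ∧ φ o ∉ V' := fun o ho =>
    ⟨(mem_filter.1 (mem_filter.1 ho).1).2, (mem_filter.1 ho).2⟩
  obtain ⟨out, inn, hout, hinn, h3, h4, h5, h6⟩ := exists_balanced_exchanges colS colO φ cent
    hφcent hβρ (k := k) (M := 6 * k + 1) (dρ := V'.card) (dβ := dβ)
    (A₀ := univ \ ((heavy φ (6 * k)).filter (colS · = β) ∪ (V' ∪ Z)))
    (I₀ := univ \ U) (Nρ := noncentral colO φ cent ρ) (Nβ := noncentral colO φ cent β \ U)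
    (K := crossing colS colO φ cent ρ β)
    (by
      have e1 : (univ.filter (colS · = ρ)).card ≤
          ((univ \ ((heavy φ (6 * k)).filter (colS · = β) ∪ (V' ∪ Z))).filter (colS · = ρ)).card +
            V'.card := by
        refine (card_le_card fun s hs => ?_).trans (card_union_le _ _)
        have hs' := (mem_filter.1 hs).2
        have h1 : colS s ≠ β := fun h => hβρ (h.symm.trans hs')
        have h2 : s ∉ Z := fun h => h1 (mem_filter.1 (hZ h)).2.2
        simp only [mem_union, mem_filter, mem_sdiff, mem_univ, true_and, hs', h2, hβρ.symm,
          and_false, and_true, or_false, false_or]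
        exact (em (s ∈ V')).symm
      have e2 : ((univ \ U).filter (colO · = ρ)).card ≤ (univ.filter (colO · = ρ)).card :=
        card_le_card (filter_subset_filter _ sdiff_subset)
      have := hcol ρ
      omega)
    (by
      have e1 : (univ.filter (colS · = β)).card ≤
          ((univ \ ((heavy φ (6 * k)).filter (colS · = β) ∪ (V' ∪ Z))).filter (colS · = β)).card +
            (((heavy φ (6 * k)).filter (colS · = β)).card + Z.card) := by
        refine (card_le_card fun s hs => ?_).trans ((card_union_le _ _).trans
          (Nat.add_le_add_left (card_union_le _ _) _))
        have hs' := (mem_filter.1 hs).2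
        have h1 : s ∉ V' := fun h => hβρ (hs'.symm.trans (mem_filter.1 h).2.1)
        simp only [mem_union, mem_filter, mem_sdiff, mem_univ, true_and, hs', h1, and_true,
          false_or]
        exact (em (s ∈ heavy φ (6 * k) ∨ s ∈ Z)).symm
      have e2 : ((univ \ U).filter (colO · = β)).card + U.card ≤
          (univ.filter (colO · = β)).card := by
        rw [← card_union_of_disjoint]
        · refine card_le_card (union_subset (filter_subset_filter _ sdiff_subset) fun o ho => ?_)
          exact mem_filter.2 ⟨mem_univ _, (hUmem o ho).1.2⟩
        · rw [disjoint_left]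
          intro o ho ho'
          exact (mem_sdiff.1 (mem_filter.1 ho).1).2 ho'
      have := hcol β
      omega)
    (fun o ho => by
      have ho' := (mem_filter.1 ho).2
      exact ⟨mem_sdiff.2 ⟨mem_univ _, fun h => hβρ ((hUmem o h).1.2.symm.trans ho'.2)⟩,
        ho'.2, ho'.1⟩)
    (fun o ho => by
      obtain ⟨ho1, ho2⟩ := mem_sdiff.1 ho
      have ho' := (mem_filter.1 ho1).2
      exact ⟨mem_sdiff.2 ⟨mem_univ _, ho2⟩, ho'.2, ho'.1⟩)
    (fun s hs => by
      have hs' := (mem_filter.1 hs).2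
      refine ⟨hs'.2.1, hs'.2.2, hs'.1, mem_sdiff.2 ⟨mem_univ _, fun h => ?_⟩⟩
      exact (hUmem _ h).1.1 (by rw [hs'.1]))
    (by
      rcases hnd with ⟨-, -, rfl⟩ | ⟨h1, -, rfl⟩
      · exact Or.inl ⟨by omega, by simp⟩
      · by_cases h : k * (heavy φ (6 * k)).card ≤ (noncentral colO φ cent β \ U).card
        · exact Or.inl ⟨by omega, h⟩
        · have hUs : U ⊆ noncentral colO φ cent β := filter_subset _ _
          have := card_sdiff_of_subset hUs
          rw [mul_add]
          exact Or.inr ⟨by omega, by omega⟩)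
    (fun s hs => by
      simp only [mem_sdiff, mem_univ, true_and, mem_union, mem_filter, not_or, not_and] at hs
      by_cases hsh : s ∈ heavy φ (6 * k)
      · have hsρ : colS s = ρ := (Bool.eq_or_eq_of_ne hβρ _).resolve_left (hs.1 hsh)
        have h1 : ((univ.filter (colO · = ρ)).filter (φ · = s)).card ≤ 6 * k := by
          by_contra h
          exact hs.2.1 (mem_filter.2 ⟨hsh, hsρ, not_le.1 h⟩)
        refine (card_le_card (t := insert (cent s)
          ((univ.filter (colO · = ρ)).filter (φ · = s))) fun o ho => ?_).trans
          ((card_insert_le _ _).trans (by omega))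
        obtain ⟨ho1, rfl⟩ := mem_filter.1 ho
        have ho2 : o ∉ U := (mem_sdiff.1 ho1).2
        by_cases hco : cent (φ o) = o
        · rw [hco]
          exact mem_insert_self _ _
        · refine mem_insert_of_mem (mem_filter.2 ⟨mem_filter.2 ⟨mem_univ _, ?_⟩, rfl⟩)
          refine (Bool.eq_or_eq_of_ne hβρ _).resolve_left fun h => ho2 ?_
          exact mem_filter.2 ⟨mem_filter.2 ⟨mem_univ _, hco, h⟩, hsh, hsρ, hs.2.1⟩
      · simp only [heavy, mem_filter, mem_univ, true_and, not_lt] at hsh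
        have := card_le_card (filter_subset_filter (φ · = s) (subset_univ (univ \ U)))
        omega)
    (fun o _ => mem_sdiff.2 ⟨mem_univ _, fun h => (hUmem _ h).1.1 (by rw [hφcent])⟩)
  refine exists_swapPlan_of_exchanges hk out inn h3 h4 h5 (U := U) (Z := Z)
    (fun z hz o ho => ?_) (fun z hz i h => ?_)
    (fun o ho => h6 o (mem_sdiff.2 ⟨mem_univ _, ho⟩)) (fun h => ?_) ?_
  · have := (mem_filter.1 (hZ hz)).2
    exact ⟨this.2.trans (hUmem o ho).1.2.symm, this.1⟩
  · exact (mem_sdiff.1 (hout i h)).2 (mem_union_right _ (mem_union_right _ hz))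
  · have := card_pos.2 h
    rw [← card_pos]
    omega
  · rw [hZc]
    exact mul_le_add_two_mul hkH2 (by omega) hUlon
      (hnd.imp (fun h => ⟨h.1, h.2.1⟩) fun h => h.2.1)

/-- With heaviness threshold `6 * k`, one of the colours has at least `3 * k` lonely facilities per
heavy facility, and can therefore bear the losses that the heavy facilities cause. -/
theorem exists_swapPlan {S O : Type*} [Fintype S] [Fintype O] [DecidableEq S] [DecidableEq O]
    (colS : S → Bool) (colO : O → Bool) (φ : O → S) (cent : S → O)
    (hcol : ∀ c, (univ.filter (colS · = c)).card = (univ.filter (colO · = c)).card)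
    (hφcent : ∀ o, φ (cent (φ o)) = φ o) {k : ℕ} (hk : 2 ≤ k) :
    Nonempty (SwapPlan colS colO φ cent k (6 * k + 1)) := by
  obtain ⟨β, ρ, hβρ, hle⟩ : ∃ β ρ : Bool, β ≠ ρ ∧
      (lonely colS φ ρ).card ≤ (lonely colS φ β).card := by
    rcases le_total (lonely colS φ true).card (lonely colS φ false).card with h | h
    · exact ⟨false, true, by decide, h⟩
    · exact ⟨true, false, by decide, h⟩
  by_cases hcase : ((heavy φ (6 * k)).filter (colS · = ρ)).card ≤
      (crossing colS colO φ cent β ρ).card ∧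
      ((heavy φ (6 * k)).filter (colS · = ρ)).card ≤ (lonely colS φ ρ).card
  · exact exists_swapPlan_of_card_heavy_le colS colO φ cent hcol hφcent hk hβρ hle hcase
  · exact exists_swapPlan_of_lt_card_heavy colS colO φ cent hcol hφcent hk hβρ hle hcase

/-! ### The approximation guarantee -/

namespace RedBlueMedian

theorem connectionCost_union_eq {X : Type*} [PseudoMetricSpace X] [DecidableEq X]
    {F : Bool → Finset X} {s : Tagged F} {j : X}
    (hs : ∀ s' : Tagged F, dist s.loc j ≤ dist s'.loc j) :
    connectionCost (F true ∪ F false) j = dist s.loc j := by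
  have hmem : s.loc ∈ F true ∪ F false := by
    obtain ⟨c, x⟩ := s
    cases c
    · exact mem_union_right _ x.2
    · exact mem_union_left _ x.2
  refine le_antisymm (connectionCost_le hmem j) ?_
  obtain ⟨x, hx, he⟩ := exists_connectionCost_eq ⟨_, hmem⟩ j
  rw [he]
  rcases mem_union.1 hx with h | h
  · exact hs ⟨true, x, h⟩
  · exact hs ⟨false, x, h⟩

theorem cost_nonneg {X : Type*} [PseudoMetricSpace X] (I : RedBlueMedian X) (F : Finset X) :
    0 ≤ I.cost F :=
  sum_nonneg fun j _ => connectionCost_nonneg F j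

theorem nonempty_tagged {X : Type*} {I : RedBlueMedian X} {R B : Finset X}
    (h : (R, B) ∈ I.feasible) :
    Nonempty (Tagged fun c => bif c then R else B) := by
  simp only [feasible, mem_product, mem_powersetCard] at h
  have := I.budget_pos
  rcases R.eq_empty_or_nonempty with rfl | ⟨x, hx⟩
  · rcases B.eq_empty_or_nonempty with rfl | ⟨x, hx⟩
    · simp only [card_empty] at h
      omega
    · exact ⟨⟨false, x, hx⟩⟩
  · exact ⟨⟨true, x, hx⟩⟩

/-- The guarantee in terms of the number `k` of exchanges of weight `1`: swaps of size `O(k ^ 2)`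
give the ratio `(5 * k + 8) / (k - 2)`. -/
theorem IsLocalOpt.mul_cost_le {X : Type*} [PseudoMetricSpace X] [DecidableEq X]
    {I : RedBlueMedian X} {p : ℕ} {R B R' B' : Finset X}
    (h : I.IsLocalOpt p R B) (h' : (R', B') ∈ I.feasible) {k : ℕ} (hk : 2 ≤ k)
    (hp : (8 * (6 * k + 1) + 1) ^ 2 ≤ p) :
    ((k : ℝ) - 2) * I.cost (R ∪ B) ≤ (5 * k + 8) * I.cost (R' ∪ B') := by
  obtain ⟨F, hF⟩ : ∃ F : Bool → Finset X, F = fun c => bif c then R else B := ⟨_, rfl⟩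
  obtain ⟨G, hG⟩ : ∃ G : Bool → Finset X, G = fun c => bif c then R' else B' := ⟨_, rfl⟩
  have hneF : Nonempty (Tagged F) := hF ▸ nonempty_tagged h.1
  have hneG : Nonempty (Tagged G) := hG ▸ nonempty_tagged h'
  choose σ hσ using fun j : X => Finite.exists_min fun s : Tagged F => dist s.loc j
  choose σ' hσ' using fun j : X => Finite.exists_min fun o : Tagged G => dist o.loc j
  choose φ hφ using fun o : Tagged G => Finite.exists_min fun s : Tagged F => dist o.loc s.loc
  have hex : ∀ s : Tagged F, ∃ o : Tagged G, ∀ o', φ o' = s →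
      φ o = s ∧ dist s.loc o.loc ≤ dist s.loc o'.loc := by
    intro s
    rcases (univ.filter (φ · = s)).eq_empty_or_nonempty with he | hne
    · refine ⟨Classical.arbitrary _, fun o' ho' => ?_⟩
      rw [filter_eq_empty_iff] at he
      exact absurd ho' (he (mem_univ o'))
    · obtain ⟨o, ho, hmin⟩ := exists_min_image _ (fun o => dist s.loc o.loc) hne
      exact ⟨o, fun o' ho' => ⟨(mem_filter.1 ho).2, hmin o' (mem_filter.2 ⟨mem_univ _, ho'⟩)⟩⟩
  choose cent hcent using hex
  have hφcent : ∀ o, φ (cent (φ o)) = φ o := fun o => (hcent _ o rfl).1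
  have hcol : ∀ c, ((univ : Finset (Tagged F)).filter (·.1 = c)).card =
      ((univ : Finset (Tagged G)).filter (·.1 = c)).card := by
    intro c
    rw [Tagged.card_filter_univ, Tagged.card_filter_univ, hF, hG]
    have h1 := h.1
    simp only [feasible, mem_product, mem_powersetCard] at h1 h'
    cases c
    · exact h1.2.2.trans h'.2.2.symm
    · exact h1.1.2.trans h'.1.2.symm
  obtain ⟨P⟩ := exists_swapPlan Sigma.fst Sigma.fst φ cent hcol hφcent hk
  have e1 : I.cost (R ∪ B) = ∑ j ∈ I.clients, dist (σ j).loc j := by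
    refine sum_congr rfl fun j _ => ?_
    rw [← connectionCost_union_eq (hσ j), hF]
    rfl
  have e2 : I.cost (R' ∪ B') = ∑ j ∈ I.clients, dist (σ' j).loc j := by
    refine sum_congr rfl fun j _ => ?_
    rw [← connectionCost_union_eq (hσ' j), hG]
    rfl
  have hswap : ∀ (A : Finset (Tagged F)) (N : Finset (Tagged G)),
      (∀ c, (N.filter (·.1 = c)).card ≤ (A.filter (·.1 = c)).card) → A.card ≤ p →
      ∀ τ : X → X, (∀ j, (∃ s, s ∉ A ∧ s.loc = τ j) ∨ ∃ o ∈ N, o.loc = τ j) →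
        ∑ j ∈ I.clients, dist (σ j).loc j ≤ ∑ j ∈ I.clients, dist (τ j) j := by
    rw [← e1]
    subst hF hG
    exact fun A N hc hA τ hτ => h.cost_le_of_exchange h' A N hc hA τ hτ
  rw [e1, e2]
  exact P.sum_dist_le I.clients Tagged.loc Tagged.loc σ σ' hφ
    (fun o => (hcent (φ o) o rfl).2) hswap hk (by omega) hp hφcent

end RedBlueMedian

theorem theorem1 :
    ∃ (γ : ℝ) (p₀ : ℕ), ∀ p : ℕ, p₀ ≤ p →
      ∀ (X : Type*) [PseudoMetricSpace X] [DecidableEq X] (I : RedBlueMedian X)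
        (R B : Finset X), I.IsLocalOpt p R B →
        I.cost (R ∪ B) ≤ (5 + γ / Real.sqrt (p : ℝ)) * I.opt := by
  refine ⟨4104, 51984, fun p hp X _ _ I R B h => ?_⟩
  obtain ⟨s, hs, hopt⟩ := exists_mem_eq_inf' I.feasible_nonempty fun s => I.cost (s.1 ∪ s.2)
  -- the largest `k` with `57 * k ≤ √p`, so that exchanges of `(48 * k + 9) ^ 2 ≤ (57 * k) ^ 2`
  -- facilities are allowed
  obtain ⟨k, hk⟩ : ∃ k, k = Nat.sqrt p / 57 := ⟨_, rfl⟩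
  have hsqrt : 228 ≤ Nat.sqrt p := Nat.le_sqrt'.2 (by omega)
  have hk4 : 4 ≤ k := by omega
  have hsize : (8 * (6 * k + 1) + 1) ^ 2 ≤ p :=
    (Nat.pow_le_pow_left (show 8 * (6 * k + 1) + 1 ≤ Nat.sqrt p by omega) 2).trans
      (Nat.sqrt_le' p)
  have hmain := h.mul_cost_le (R' := s.1) (B' := s.2) hs (by omega) hsize
  have hopt' : I.opt = I.cost (s.1 ∪ s.2) := hopt
  rw [hopt']
  have hO := I.cost_nonneg (s.1 ∪ s.2)
  generalize I.cost (s.1 ∪ s.2) = c' at *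
  generalize I.cost (R ∪ B) = c at *
  have hk4' : (4 : ℝ) ≤ k := by exact_mod_cast hk4
  have hroot : Real.sqrt p ≤ 114 * k := by
    rw [Real.sqrt_le_iff]
    refine ⟨by positivity, ?_⟩
    have h1 : p ≤ (114 * k) ^ 2 :=
      (Nat.sqrt_lt'.1 (show Nat.sqrt p < 114 * k by omega)).le
    exact_mod_cast h1
  have hroot0 : 0 < Real.sqrt p := Real.sqrt_pos.2 (by
    have : 0 < p := by omega
    exact_mod_cast this)
  have hc : c ≤ (5 + 36 / k) * c' := by
    have h1 : (5 * k + 8 : ℝ) ≤ (k - 2) * (5 + 36 / k) := by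
      have h2 : (k - 2 : ℝ) * (5 + 36 / k) = 5 * k + 26 - 72 / k := by
        field_simp
        ring
      have h3 : (72 / k : ℝ) ≤ 18 := by
        rw [div_le_iff₀ (by linarith)]
        linarith
      linarith
    have h2 := hmain.trans (mul_le_mul_of_nonneg_right h1 hO)
    rw [mul_assoc] at h2
    exact le_of_mul_le_mul_left h2 (by linarith)
  refine hc.trans (mul_le_mul_of_nonneg_right ?_ hO)
  have h1 : (36 / k : ℝ) ≤ 4104 / Real.sqrt p := by
    rw [div_le_div_iff₀ (by linarith) hroot0]
    linarith
  linarith
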